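/- Let $0\le h\le n$ be integers, $A=\{1,\dots,h\}$, $B=\{h+1,\dots,n\}$, and let $S_{n-h}\times S_h\le S_n$ be the stabilizer of $A$. For a finite set $X$ with $|X|=t$, let $M^{t-m,m}(X)$ be the space of complex functions on the $m$-subsets of $X$; write $\delta_Z$ for the Dirac function at $Z\subseteq X$, and put $$d\,\delta_Z=\sum_{x\in Z}\delta_{Z\setminus\{x\}},\qquad d^*\delta_Z=\sum_{x\in X\setminus Z}\delta_{Z\cup\{x\}},\qquad R_q=\frac{(d^*)^q}{q!},\qquad S^{t-k,k}(X)=M^{t-k,k}(X)\cap\operatorname{Ker} d ,$$ where $d$ is zero on $M^{t,0}(X)$; the symmetric group of $X$ acts on these spaces by $(gf)(Z)=f(g^{-1}Z)$. Write $S^{n-k,k}=S^{n-k,k}(\{1,\dots,n\})$. For functions $\phi$ on subsets of $A$ and $\psi$ on subsets of $B$, $\phi\otimes\psi$ is identified with the function $Z\mapsto\phi(Z\cap A)\psi(Z\cap B)$ on subsets of $\{1,\dots,n\}$, so that $\delta_Y\otimes\delta_{Y'}=\delta_{Y\cup Y'}$. With $(x)_r=x(x+1)\cdots(x+r-1)$,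 the one-variable Hahn polynomials are $$E_m(a,b,c,x)=\sum_{s=\max\{0,x-c+m\}}^{\min\{m,x\}}(-1)^s\binom ms(b-m+1)_s(-x)_s(a-m+1)_{m-s}(x-c)_{m-s}.$$ For integers $k,i,j\ge 0$ consider the condition $$(\ast)\qquad k-h\le j-i\le n-h-k\quad\text{and}\quad i+j\le k .$$ **(1)** Let $k,i,j\ge 0$ be integers with $i\le h/2$ and $j\le (n-h)/2$, and let $0\ne\phi\in S^{h-i,i}(A)$, $0\ne\psi\in S^{n-h-j,j}(B)$. The equation $$d\sum_{l=\max\{i-h+k,\,j\}}^{\min\{k-i,\,n-h-j\}}\alpha_l\,(R_{k-l-i}\phi)\otimes(R_{l-j}\psi)=0$$ in the unknown complex coefficients $\alpha_l$ (with $l$ in the range of summation) has a nontrivial solution if and only if $(\ast)$ holds. If $(\ast)$ holds, then the range of summation is $j\le l\le k-i$ and the solutions are exactly $$\alpha_l=\alpha\,E_{k-i-j}(n-h-2j,\,h-2i,\,k-i-j,\,l-j),\qquad l=j,j+1,\dots,k-i,$$ with $\alpha\in\mathbb C$ an arbitrary constant. **(2)** Let $0\le k\le n/2$. For $0\le i\le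 h/2$ and $0\le j\le (n-h)/2$ the representation $S^{h-i,i}(A)\otimes S^{n-h-j,j}(B)$ of $S_{n-h}\times S_h$ is irreducible, and its multiplicity in $\operatorname{Res}^{S_n}_{S_{n-h}\times S_h}S^{n-k,k}$ (the dimension of the space of intertwining maps from the former to the latter) is $1$ if $(\ast)$ holds and $0$ otherwise. **(3)** Let $0\le k\le n/2$. For all $0\le i\le h/2$, $0\le j\le (n-h)/2$ satisfying $(\ast)$, the rule $$\phi\otimes\psi\longmapsto\sum_{l=j}^{k-i}E_{k-i-j}(n-h-2j,\,h-2i,\,k-i-j,\,l-j)\,(R_{k-l-i}\phi)\otimes(R_{l-j}\psi)$$ defines an injective intertwining map of $S^{h-i,i}(A)\otimes S^{n-h-j,j}(B)$ into $\operatorname{Res}^{S_n}_{S_{n-h}\times S_h}S^{n-k,k}$. The space $S^{n-k,k}$ is the direct sum of the images of these maps, and the representations $S^{h-i,i}(A)\otimes S^{n-h-j,j}(B)$ for distinct such pairs $(i,j)$ are inequivalent. Thus $$\operatorname{Res}^{S_n}_{S_{n-h}\times S_h}S^{n-k,k}=\bigoplus_{(i,j)}S^{h-i,i}(A)\otimes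 S^{n-h-j,j}(B)$$ is a multiplicity-free decomposition, the sum being over all $i,j$ with $0\le i\le h/2$, $0\le j\le (n-h)/2$ and $(\ast)$. -/

import Mathlib

open scoped TensorProduct

noncomputable section

namespace TwoRow

/-! ### One-variable Hahn polynomials -/

/-- The rising factorial `(x)_k = x (x+1) ⋯ (x+k-1)` over the integers. -/
def poch (x : ℤ) (k : ℕ) : ℤ := ∏ t ∈ Finset.range k, (x + (t : ℤ))

/-- The Hahn polynomial (in Dunkl's normalization) `E_m(a,b,c,x)`, that is the sum over
`max {0, x-c+m} ≤ j ≤ min {m, x}` of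
`(-1)^j binom(m,j) (b-m+1)_j (-x)_j (a-m+1)_{m-j} (x-c)_{m-j}`. -/
def hahnE (m : ℕ) (a b c x : ℤ) : ℤ :=
  ∑ j ∈ (Finset.range (m + 1)).filter (fun j : ℕ => x - c + (m : ℤ) ≤ (j : ℤ) ∧ (j : ℤ) ≤ x),
    (-1) ^ j * (m.choose j : ℤ) * poch (b - m + 1) j * poch (-x) j
      * poch (a - m + 1) (m - j) * poch (x - c) (m - j)

/-! ### Functions on subsets and Radon transforms -/

section Radon

set_option linter.unusedSectionVars false

variable (X : Type) [Fintype X] [DecidableEq X]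

/-- The space of functions on the `m`-subsets of `X` (written `M^{t-m,m}(X)`, `t = |X|`),
realized as the functions on all subsets of `X` that vanish off the `m`-subsets. -/
def funM (m : ℕ) : Submodule ℂ (Finset X → ℂ) where
  carrier := {f | ∀ Z : Finset X, Z.card ≠ m → f Z = 0}
  add_mem' := by
    intro f g hf hg Z hZ
    simp [hf Z hZ, hg Z hZ]
  zero_mem' := by
    intro Z _
    rfl
  smul_mem' := by
    intro c f hf Z hZ
    simp [hf Z hZ]

variable {X}

/-- The Dirac function at a subset `A`. -/
def dirac (A : Finset X) : Finset X → ℂ := Pi.single A 1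

variable (X)

/-- The Radon transform `d`, determined by `d δ_A = ∑_{x ∈ A} δ_{A \ {x}}`. -/
def radonD : (Finset X → ℂ) →ₗ[ℂ] (Finset X → ℂ) :=
  (Pi.basisFun ℂ (Finset X)).constr ℂ (fun A => ∑ x ∈ A, dirac (A.erase x))

/-- The Radon transform `d^*`, determined by `d^* δ_A = ∑_{x ∉ A} δ_{A ∪ {x}}`. -/
def radonDstar : (Finset X → ℂ) →ₗ[ℂ] (Finset X → ℂ) :=
  (Pi.basisFun ℂ (Finset X)).constr ℂ (fun A => ∑ x ∈ Aᶜ, dirac (insert x A))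

/-- The divided power `R_q = (d^*)^q / q!`. -/
def radonR (q : ℕ) : (Finset X → ℂ) →ₗ[ℂ] (Finset X → ℂ) :=
  ((q.factorial : ℂ)⁻¹) • (radonDstar X) ^ q

/-- The space `S^{t-k,k}(X) = M^{t-k,k}(X) ∩ Ker d`, where `t = |X|`. -/
def spaceS (k : ℕ) : Submodule ℂ (Finset X → ℂ) := funM X k ⊓ LinearMap.ker (radonD X)

/-- The permutation representation of the symmetric group of `X` on functions of subsets of `X`:
`(g f)(Z) = f (g⁻¹ Z)`. -/
def permRep : Representation ℂ (Equiv.Perm X) (Finset X → ℂ) where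
  toFun g := LinearMap.funLeft ℂ ℂ (fun Z : Finset X => Z.map g.symm.toEmbedding)
  map_one' := by
    refine LinearMap.ext (fun f => funext (fun Z => congrArg f ?_))
    ext x
    simp
  map_mul' g g' := by
    refine LinearMap.ext (fun f => funext (fun Z => congrArg f ?_))
    ext x
    simp

variable {X}

theorem radonD_dirac (A : Finset X) : radonD X (dirac A) = ∑ x ∈ A, dirac (A.erase x) := by
  have h := (Pi.basisFun ℂ (Finset X)).constr_basis ℂ (fun A => ∑ x ∈ A, dirac (A.erase x)) A
  rw [Pi.basisFun_apply] at h
  exact h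

theorem permRep_dirac (g : Equiv.Perm X) (A : Finset X) :
    permRep X g (dirac A) = dirac (A.map g.toEmbedding) := by
  ext Z
  have h : (Z.map g.symm.toEmbedding = A) ↔ (Z = A.map g.toEmbedding) := by
    constructor
    · rintro rfl
      ext x
      simp
    · rintro rfl
      ext x
      simp
  simp only [permRep, MonoidHom.coe_mk, OneHom.coe_mk, LinearMap.funLeft_apply, dirac,
    Pi.single_apply, h]

theorem radonD_permRep (g : Equiv.Perm X) (f : Finset X → ℂ) :
    radonD X (permRep X g f) = permRep X g (radonD X f) := by
  have h : radonD X ∘ₗ permRep X g = permRep X g ∘ₗ radonD X := by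
    refine (Pi.basisFun ℂ (Finset X)).ext (fun A => ?_)
    rw [Pi.basisFun_apply]
    change radonD X (permRep X g (dirac A)) = permRep X g (radonD X (dirac A))
    rw [permRep_dirac, radonD_dirac, radonD_dirac, map_sum, Finset.sum_map]
    refine Finset.sum_congr rfl (fun x _ => ?_)
    rw [permRep_dirac, Finset.map_erase]
  exact LinearMap.congr_fun h f

theorem spaceS_le_comap (k : ℕ) (g : Equiv.Perm X) :
    spaceS X k ≤ (spaceS X k).comap (permRep X g) := by
  rintro f ⟨hf, hd⟩
  refine ⟨fun Z hZ => hf _ ?_, ?_⟩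
  · simpa using hZ
  · rw [SetLike.mem_coe, LinearMap.mem_ker, radonD_permRep, LinearMap.mem_ker.mp hd, map_zero]

variable (X)

/-- `S^{t-k,k}(X)` as a representation of the symmetric group of `X`. -/
def repS (k : ℕ) : Representation ℂ (Equiv.Perm X) (spaceS X k) :=
  (permRep X).subrepresentation (spaceS X k) (spaceS_le_comap k)

end Radon

/-! ### The two-block partition and restriction -/

section Blocks

/-- Membership in the block `A`, consisting of the first `h` of the `n` points. -/
abbrev inA (n h : ℕ) : Fin n → Prop := fun x => (x : ℕ) < h

/-- The block `A` of the first `h` points. -/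
abbrev BlockA (n h : ℕ) : Type := {x : Fin n // inA n h x}

/-- The block `B`, the complement of `A`. -/
abbrev BlockB (n h : ℕ) : Type := {x : Fin n // ¬ inA n h x}

/-- The group `S_h × S_{n-h}`, as the product of the symmetric groups of `A` and of `B`. -/
abbrev Young (n h : ℕ) : Type := Equiv.Perm (BlockA n h) × Equiv.Perm (BlockB n h)

/-- The inclusion of `S_h × S_{n-h}` into `S_n`. -/
def youngHom (n h : ℕ) : Young n h →* Equiv.Perm (Fin n) :=
  Equiv.Perm.subtypeCongrHom (inA n h)

/-- The image of `S_h × S_{n-h}` in `S_n` is the stabilizer of `A`. -/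
theorem mem_range_youngHom (n h : ℕ) (g : Equiv.Perm (Fin n)) :
    g ∈ (youngHom n h).range ↔ ∀ x, inA n h (g x) ↔ inA n h x := by
  constructor
  · rintro ⟨⟨a, b⟩, rfl⟩ x
    by_cases hx : inA n h x
    · simp only [youngHom, Equiv.Perm.subtypeCongrHom, MonoidHom.coe_mk, OneHom.coe_mk,
        Equiv.Perm.subtypeCongr.left_apply _ _ hx]
      exact iff_of_true (a ⟨x, hx⟩).2 hx
    · simp only [youngHom, Equiv.Perm.subtypeCongrHom, MonoidHom.coe_mk, OneHom.coe_mk,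
        Equiv.Perm.subtypeCongr.right_apply _ _ hx]
      exact iff_of_false (b ⟨x, hx⟩).2 hx
  · intro hg
    refine ⟨⟨g.subtypePerm hg, g.subtypePerm (fun x => not_congr (hg x))⟩, ?_⟩
    ext x
    by_cases hx : inA n h x
    · simp only [youngHom, Equiv.Perm.subtypeCongrHom, MonoidHom.coe_mk, OneHom.coe_mk,
        Equiv.Perm.subtypeCongr.left_apply _ _ hx, Equiv.Perm.subtypePerm_apply]
    · simp only [youngHom, Equiv.Perm.subtypeCongrHom, MonoidHom.coe_mk, OneHom.coe_mk,
        Equiv.Perm.subtypeCongr.right_apply _ _ hx, Equiv.Perm.subtypePerm_apply]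

/-- The tensor product of a function on subsets of `A` and a function on subsets of `B`, viewed
as the function `Z ↦ φ (Z ∩ A) ψ (Z ∩ B)` on subsets of the whole set;
thus `δ_X ⊗ δ_Y = δ_{X ∪ Y}`. -/
def box (n h : ℕ) (φ : Finset (BlockA n h) → ℂ) (ψ : Finset (BlockB n h) → ℂ) :
    Finset (Fin n) → ℂ :=
  fun Z => φ (Z.subtype (inA n h)) * ψ (Z.subtype (fun x => ¬ inA n h x))

/-- The underlying space of `S^{h-i,i}(A) ⊗ S^{n-h-j,j}(B)`. -/
abbrev SS (n h i j : ℕ) : Type := (spaceS (BlockA n h) i) ⊗[ℂ] (spaceS (BlockB n h) j)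

/-- The (outer) tensor product representation `S^{h-i,i}(A) ⊗ S^{n-h-j,j}(B)` of the group
`S_h × S_{n-h}`. -/
def repSS (n h i j : ℕ) : Representation ℂ (Young n h) (SS n h i j) :=
  Representation.tprod
    ((repS (BlockA n h) i).comp (MonoidHom.fst _ _))
    ((repS (BlockB n h) j).comp (MonoidHom.snd _ _))

/-- The restriction of `S^{n-k,k}` from `S_n` to `S_h × S_{n-h}`. -/
def resS (n h k : ℕ) : Representation ℂ (Young n h) (spaceS (Fin n) k) :=
  (repS (Fin n) k).comp (youngHom n h)

/-- The multiplicity of an irreducible complex representation `ρ` in a representation `σ`: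
the dimension of the space of intertwining maps from `ρ` to `σ`. -/
def multiplicity {G V W : Type} [Monoid G] [AddCommMonoid V] [Module ℂ V] [AddCommMonoid W]
    [Module ℂ W] (ρ : Representation ℂ G V) (σ : Representation ℂ G W) : ℕ :=
  Module.finrank ℂ (Representation.IntertwiningMap ρ σ)

/-- The conditions `k - h ≤ j - i ≤ n - h - k` and `i + j ≤ k`. -/
def LRCond (n h k i j : ℕ) : Prop :=
  (k : ℤ) - h ≤ (j : ℤ) - i ∧ (j : ℤ) - i ≤ (n : ℤ) - h - k ∧ i + j ≤ k

/-- The pairs `(i, j)` with `0 ≤ i ≤ h/2`, `0 ≤ j ≤ (n-h)/2` that satisfy `LRCond`. -/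
abbrev LRPair (n h k : ℕ) : Type :=
  {p : ℕ × ℕ // 2 * p.1 ≤ h ∧ 2 * p.2 + h ≤ n ∧ LRCond n h k p.1 p.2}

/-- The coefficient `E_{k-i-j}(n-h-2j, h-2i, k-i-j, l-j)`, as a complex number. -/
def lrCoeff (n h k i j l : ℕ) : ℂ :=
  (hahnE (k - i - j) ((n : ℤ) - h - 2 * j) ((h : ℤ) - 2 * i) ((k : ℤ) - i - j)
    ((l : ℤ) - j) : ℂ)

/-- The range `max {i-h+k, j} ≤ l ≤ min {k-i, n-h-j}` of the summation index `l`. -/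
def lRange (n h k i j : ℕ) : Finset ℕ :=
  (Finset.range (k + 1)).filter
    (fun l => i + k ≤ l + h ∧ j ≤ l ∧ l + i ≤ k ∧ l + h + j ≤ n)

end Blocks

end TwoRow

end

/-!
The operators `d` and `d^*` on functions on subsets of a `t`-set `X` generate an action of `𝔰𝔩₂`, in
which the functions on `m`-subsets have weight `2m - t` (`radonD_radonDstar_apply`) and `S^{t-i,i}`
consists of the lowest weight vectors in degree `i`. Such a vector `φ ≠ 0` generates the string
`R_q φ`, `0 ≤ q ≤ t - 2i`, on which `d R_{q+1} φ = (t - 2i - q) R_q φ`, and all functions are sums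
of members of strings (`exists_eq_sum_radonR`): as `d` and `d^*` are adjoint, a function orthogonal
to all strings is, by induction on its degree, itself a lowest weight vector, hence zero.

For the union of two blocks `d` satisfies the Leibniz rule. With `m = k - i - j`, `a = h - 2i` and
`b = n - h - 2j`, the equation `d ∑ (R_{m-p} ⊗ R_p) t_p = 0` for a sequence `t_p` in
`S^{h-i,i}(A) ⊗ S^{n-h-j,j}(B)` is the two-term recursion
`(a - (m - 1 - p)) t_p + (b - p) t_{p+1} = 0` (`radonD_stringSum_eq_zero_iff`). The
Littlewood-Richardson condition says `0 ≤ m ≤ min a b`; then no coefficient vanishes and the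
solutions are the multiples of the Hahn coefficients, which collapse to products of two rising
factorials (`recursion_iff_of_LRCond`). Otherwise a boundary equation has a single term, and all
`t_p` vanish (`eq_zero_of_recursion`). Taking `t_p` to be a multiple of `φ ⊗ ψ` solves the equation
of the theorem.

In `S^{t-k,k}` the functions fixed by the stabilizer of a `k`-set `Y` are the multiples of the zonal
function at `Y`, and the zonal functions are a reproducing kernel. Averaging over stabilizers thus
moves any nonzero invariant subspace of `S^{h-i,i}(A) ⊗ S^{n-h-j,j}(B)` onto products of zonal
functions, which span (`isIrreducible_repSS`). The sum of all transpositions acts on `S^{t-i,i}` by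
a scalar that determines `i` for `i ≤ t/2`; combining the two sums for `A` and `B` into one operator
`swapSum`, the pairs `(i, j)` are told apart by its eigenvalue in every representation of
`S_h × S_{n-h}`. This gives the inequivalence and the independence of the summands, and it splits an
element of `S^{n-k,k}` into its parts belonging to the pairs `(i, j)`, each again killed by `d` and
so, by the recursion, in the image of the immersion `lrMap` (`iSup_range_lrMap`). Multiplicities
follow by Schur's lemma.
-/

namespace TwoRow

/-! ### The `𝔰𝔩₂`-strings -/

section Radon

set_option linter.unusedSectionVars false

variable {X : Type} [Fintype X] [DecidableEq X]

theorem radonD_apply (f : Finset X → ℂ) (W : Finset X) :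
    radonD X f W = ∑ y ∈ Wᶜ, f (insert y W) := by
  have h : radonD X = LinearMap.pi (fun W : Finset X =>
      ∑ y ∈ Wᶜ, LinearMap.proj (R := ℂ) (φ := fun _ : Finset X => ℂ) (insert y W)) := by
    refine (Pi.basisFun ℂ (Finset X)).ext (fun A => ?_)
    rw [Pi.basisFun_apply]
    change radonD X (dirac A) = _
    rw [radonD_dirac]
    ext W
    simp only [dirac, Finset.sum_apply, Pi.single_apply, LinearMap.pi_apply, LinearMap.sum_apply,
      LinearMap.proj_apply, ← Finset.sum_filter, Finset.sum_const]
    congr 2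
    ext x
    simp only [Finset.mem_filter, Finset.mem_compl]
    constructor
    · rintro ⟨hx, rfl⟩
      exact ⟨Finset.notMem_erase _ _, Finset.insert_erase hx⟩
    · rintro ⟨hx, rfl⟩
      exact ⟨Finset.mem_insert_self _ _, (Finset.erase_insert hx).symm⟩
  rw [h]
  simp

theorem radonDstar_dirac (A : Finset X) :
    radonDstar X (dirac A) = ∑ x ∈ Aᶜ, dirac (insert x A) := by
  have h := (Pi.basisFun ℂ (Finset X)).constr_basis ℂ
    (fun A => ∑ x ∈ Aᶜ, dirac (insert x A)) A
  rw [Pi.basisFun_apply] at h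
  exact h

theorem radonDstar_apply (f : Finset X → ℂ) (W : Finset X) :
    radonDstar X f W = ∑ x ∈ W, f (W.erase x) := by
  have h : radonDstar X = LinearMap.pi (fun W : Finset X =>
      ∑ x ∈ W, LinearMap.proj (R := ℂ) (φ := fun _ : Finset X => ℂ) (W.erase x)) := by
    refine (Pi.basisFun ℂ (Finset X)).ext (fun A => ?_)
    rw [Pi.basisFun_apply]
    change radonDstar X (dirac A) = _
    rw [radonDstar_dirac]
    ext W
    simp only [dirac, Finset.sum_apply, Pi.single_apply, LinearMap.pi_apply, LinearMap.sum_apply,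
      LinearMap.proj_apply, ← Finset.sum_filter, Finset.sum_const]
    congr 2
    ext x
    simp only [Finset.mem_filter, Finset.mem_compl]
    constructor
    · rintro ⟨hx, rfl⟩
      exact ⟨Finset.mem_insert_self _ _, Finset.erase_insert hx⟩
    · rintro ⟨hx, rfl⟩
      exact ⟨Finset.notMem_erase _ _, (Finset.insert_erase hx).symm⟩
  rw [h]
  simp

/-- The `𝔰𝔩₂` relation: on `m`-subsets of a `t`-set, `d d^* - d^* d` is the scalar `t - 2m`. -/
theorem radonD_radonDstar_apply (f : Finset X → ℂ) (W : Finset X) :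
    radonD X (radonDstar X f) W =
      radonDstar X (radonD X f) W + ((Fintype.card X : ℂ) - 2 * W.card) * f W := by
  have h1 : radonD X (radonDstar X f) W =
      (Wᶜ.card : ℂ) * f W + ∑ y ∈ Wᶜ, ∑ x ∈ W, f (insert y (W.erase x)) := by
    rw [radonD_apply, ← nsmul_eq_mul, ← Finset.sum_const, ← Finset.sum_add_distrib]
    refine Finset.sum_congr rfl (fun y hy => ?_)
    rw [Finset.mem_compl] at hy
    rw [radonDstar_apply, Finset.sum_insert hy, Finset.erase_insert hy]
    congr 1
    refine Finset.sum_congr rfl (fun x hx => ?_)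
    rw [Finset.erase_insert_of_ne (ne_of_mem_of_not_mem hx hy).symm]
  have h2 : radonDstar X (radonD X f) W =
      (W.card : ℂ) * f W + ∑ x ∈ W, ∑ y ∈ Wᶜ, f (insert y (W.erase x)) := by
    rw [radonDstar_apply, ← nsmul_eq_mul, ← Finset.sum_const, ← Finset.sum_add_distrib]
    refine Finset.sum_congr rfl (fun x hx => ?_)
    rw [radonD_apply, Finset.compl_erase, Finset.sum_insert (by simpa using hx),
      Finset.insert_erase hx]
  rw [h1, h2, Finset.sum_comm, Finset.card_compl, Nat.cast_sub (Finset.card_le_univ W)]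
  ring

theorem radonD_mem {f : Finset X → ℂ} {m : ℕ} (hf : f ∈ funM X (m + 1)) :
    radonD X f ∈ funM X m := by
  intro W hW
  rw [radonD_apply]
  refine Finset.sum_eq_zero (fun y hy => hf _ ?_)
  rw [Finset.card_insert_of_notMem (by simpa using hy)]
  omega

theorem radonDstar_mem {f : Finset X → ℂ} {m : ℕ} (hf : f ∈ funM X m) :
    radonDstar X f ∈ funM X (m + 1) := by
  intro W hW
  rw [radonDstar_apply]
  refine Finset.sum_eq_zero (fun y hy => hf _ ?_)
  have := Finset.card_erase_add_one hy
  omega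

/-- Functions on the empty set are killed by `d`. -/
theorem radonD_eq_zero_of_mem_funM_zero {f : Finset X → ℂ} (hf : f ∈ funM X 0) :
    radonD X f = 0 := by
  ext W
  rw [radonD_apply]
  exact Finset.sum_eq_zero (fun y _ => hf _ (by simp))

theorem radonR_zero : radonR X 0 = LinearMap.id := by
  ext
  simp [radonR]

theorem radonDstar_radonR (q : ℕ) (f : Finset X → ℂ) :
    radonDstar X (radonR X q f) = ((q : ℂ) + 1) • radonR X (q + 1) f := by
  have hq : ((q : ℂ) + 1) ≠ 0 := Nat.cast_add_one_ne_zero q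
  simp only [radonR, LinearMap.smul_apply, map_smul, pow_succ', Module.End.mul_apply, smul_smul,
    Nat.factorial_succ, Nat.cast_mul, Nat.cast_add, Nat.cast_one, mul_inv]
  rw [← mul_assoc, mul_inv_cancel₀ hq, one_mul]

theorem radonR_mem {f : Finset X → ℂ} {m : ℕ} (hf : f ∈ funM X m) (q : ℕ) :
    radonR X q f ∈ funM X (m + q) := by
  refine Submodule.smul_mem _ _ ?_
  induction q with
  | zero => exact hf
  | succ q ih =>
    rw [pow_succ', Module.End.mul_apply]
    exact radonDstar_mem ih

/-- The action of `d` on the string generated by a lowest weight vector. -/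
theorem radonD_radonR_succ {i : ℕ} {φ : Finset X → ℂ} (hφ : φ ∈ spaceS X i) (q : ℕ) :
    radonD X (radonR X (q + 1) φ) = ((Fintype.card X : ℂ) - 2 * i - q) • radonR X q φ := by
  have key : ∀ g ∈ funM X (i + q), radonD X (radonDstar X g) =
      radonDstar X (radonD X g) + ((Fintype.card X : ℂ) - 2 * (i + q)) • g := by
    intro g hg
    ext W
    rw [radonD_radonDstar_apply]
    by_cases hW : W.card = i + q
    · simp [hW]
    · simp [hg W hW]
  have hq : ((q : ℂ) + 1) ≠ 0 := Nat.cast_add_one_ne_zero q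
  refine smul_right_injective _ hq ?_
  change ((q : ℂ) + 1) • _ = ((q : ℂ) + 1) • _
  rw [← map_smul, ← radonDstar_radonR, key _ (radonR_mem hφ.1 q)]
  cases q with
  | zero =>
    have h0 : radonD X φ = 0 := hφ.2
    simp [radonR_zero, h0]
  | succ q =>
    rw [radonD_radonR_succ hφ q, map_smul, radonDstar_radonR, smul_smul, ← add_smul, smul_smul]
    congr 1
    push_cast
    ring

theorem radonR_eq_zero_of_succ {i : ℕ} {φ : Finset X → ℂ} (hφ : φ ∈ spaceS X i) {q : ℕ}
    (hq : radonR X (q + 1) φ = 0) (hne : Fintype.card X ≠ 2 * i + q) : radonR X q φ = 0 := by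
  have h := radonD_radonR_succ hφ q
  rw [hq, map_zero] at h
  refine (smul_eq_zero.mp h.symm).resolve_left (fun h0 => hne ?_)
  have : (Fintype.card X : ℂ) = ((2 * i + q : ℕ) : ℂ) := by
    push_cast
    linear_combination h0
  exact_mod_cast this

theorem funM_eq_zero {m : ℕ} (hm : Fintype.card X < m) {f : Finset X → ℂ} (hf : f ∈ funM X m) :
    f = 0 := by
  ext Z
  exact hf Z (by have := Finset.card_le_univ Z; omega)

/-- There are no nonzero lowest weight vectors above the middle level. -/
theorem spaceS_eq_zero {k : ℕ} (hk : Fintype.card X < 2 * k) {φ : Finset X → ℂ}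
    (hφ : φ ∈ spaceS X k) : φ = 0 := by
  have h : ∀ q, radonR X q φ = 0 → φ = 0 := by
    intro q
    induction q with
    | zero => simp [radonR_zero]
    | succ q ih => exact fun hq => ih (radonR_eq_zero_of_succ hφ hq (by omega))
  exact h (Fintype.card X + 1) (funM_eq_zero (by omega) (radonR_mem hφ.1 _))

/-- The string of a lowest weight vector of degree `i` stops at `q = t - 2i`: the next member would
be a lowest weight vector above the middle level. -/
theorem radonR_eq_zero {i : ℕ} {φ : Finset X → ℂ} (hφ : φ ∈ spaceS X i) {q : ℕ}
    (hq : Fintype.card X < 2 * i + q) : radonR X q φ = 0 := by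
  induction q with
  | zero => rw [radonR_zero]; exact spaceS_eq_zero (by omega) hφ
  | succ q ih =>
    by_cases h : Fintype.card X < 2 * i + q
    · have h2 := radonDstar_radonR q φ
      rw [ih h, map_zero] at h2
      exact (smul_eq_zero.mp h2.symm).resolve_left (Nat.cast_add_one_ne_zero q)
    · refine spaceS_eq_zero (k := i + (q + 1)) (by omega) ⟨radonR_mem hφ.1 _, ?_⟩
      have h0 : (Fintype.card X : ℂ) = 2 * i + q := by
        have : Fintype.card X = 2 * i + q := by omega
        rw [this]; push_cast; ring
      rw [SetLike.mem_coe, LinearMap.mem_ker, radonD_radonR_succ hφ, h0]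
      simp

/-- No member of the string of a nonzero lowest weight vector vanishes before the end. -/
theorem eq_zero_of_radonR_eq_zero {i : ℕ} {φ : Finset X → ℂ} (hφ : φ ∈ spaceS X i) {q : ℕ}
    (hq : 2 * i + q ≤ Fintype.card X) (h : radonR X q φ = 0) : φ = 0 := by
  induction q with
  | zero => simpa [radonR_zero] using h
  | succ q ih => exact ih (by omega) (radonR_eq_zero_of_succ hφ h (by omega))

/-! ### Decomposition of the functions on `m`-subsets -/

/-- `d` and `d^*` are adjoint to each other. -/
theorem sum_star_radonD_mul (f g : Finset X → ℂ) :
    ∑ Z, star (radonD X f Z) * g Z = ∑ Z, star (f Z) * radonDstar X g Z := by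
  simp only [radonD_apply, radonDstar_apply, star_sum, Finset.sum_mul, Finset.mul_sum]
  rw [Finset.sum_sigma', Finset.sum_sigma']
  refine Finset.sum_nbij' (fun p => ⟨insert p.2 p.1, p.2⟩) (fun p => ⟨p.1.erase p.2, p.2⟩)
    ?_ ?_ ?_ ?_ ?_
  · rintro ⟨Z, y⟩ h
    simp
  · rintro ⟨Z, y⟩ h
    simp
  · rintro ⟨Z, y⟩ h
    simp only [Finset.mem_sigma, Finset.mem_univ, Finset.mem_compl, true_and] at h
    simp [Finset.erase_insert h]
  · rintro ⟨Z, y⟩ h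
    simp only [Finset.mem_sigma, Finset.mem_univ, true_and] at h
    simp [Finset.insert_erase h]
  · rintro ⟨Z, y⟩ h
    simp only [Finset.mem_sigma, Finset.mem_univ, Finset.mem_compl, true_and] at h
    simp [Finset.erase_insert h]

theorem eq_zero_of_sum_star_mul_self {f : Finset X → ℂ} (h : ∑ Z, star (f Z) * f Z = 0) :
    f = 0 := by
  open scoped ComplexOrder in
  exact dotProduct_star_self_eq_zero.mp (by simpa [dotProduct, mul_comm] using h)

/-- A function on `m`-subsets orthogonal to all strings is zero: its image under `d` has the same
property, so by induction it is itself a lowest weight vector. -/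
theorem eq_zero_of_orthogonal_strings (m : ℕ) : ∀ f ∈ funM X m,
    (∀ i ≤ m, ∀ φ ∈ spaceS X i, ∑ Z, star (f Z) * radonR X (m - i) φ Z = 0) → f = 0 := by
  induction m with
  | zero =>
    intro f hf h
    have h0 := h 0 le_rfl f ⟨hf, radonD_eq_zero_of_mem_funM_zero hf⟩
    simp only [Nat.sub_self, radonR_zero, LinearMap.id_apply] at h0
    exact eq_zero_of_sum_star_mul_self h0
  | succ m ih =>
    intro f hf h
    have hd : radonD X f = 0 := by
      refine ih _ (radonD_mem hf) (fun i hi φ hφ => ?_)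
      rw [sum_star_radonD_mul, radonDstar_radonR]
      have h1 := h i (by omega) φ hφ
      rw [show m + 1 - i = m - i + 1 by omega] at h1
      simp only [Pi.smul_apply, smul_eq_mul, mul_left_comm, ← Finset.mul_sum]
      rw [h1, mul_zero]
    have h0 := h (m + 1) le_rfl f ⟨hf, hd⟩
    simp only [Nat.sub_self, radonR_zero, LinearMap.id_apply] at h0
    exact eq_zero_of_sum_star_mul_self h0

/-- Every function on `m`-subsets is a sum of members of strings. -/
theorem exists_eq_sum_radonR {m : ℕ} {f : Finset X → ℂ} (hf : f ∈ funM X m) :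
    ∃ φ : ∀ i : ℕ, spaceS X i, f = ∑ i ∈ Finset.range (m + 1), radonR X (m - i) (φ i) := by
  set N : Submodule ℂ (Finset X → ℂ) :=
    ⨆ i ∈ Finset.range (m + 1), (spaceS X i).map (radonR X (m - i)) with hN
  have hNM : f ∈ N := by
    by_contra hfN
    obtain ⟨l, hl, hlN⟩ := Submodule.exists_le_ker_of_notMem hfN
    -- the functional `l` restricted to `m`-subsets is the pairing with the function `c`
    set c : Finset X → ℂ := fun Z => if Z.card = m then star (l (dirac Z)) else 0 with hc
    have hpair : ∀ g ∈ funM X m, ∑ Z, star (c Z) * g Z = l g := by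
      intro g hg
      rw [LinearMap.pi_apply_eq_sum_univ l g]
      refine Finset.sum_congr rfl (fun Z _ => ?_)
      by_cases hZ : Z.card = m
      · have : (fun j => if Z = j then (1 : ℂ) else 0) = dirac Z := by
          ext j
          simp [dirac, Pi.single_apply, eq_comm]
        simp [hc, hZ, this, mul_comm]
      · simp [hc, hZ, hg Z hZ]
    have hc0 : c = 0 := by
      refine eq_zero_of_orthogonal_strings m c (fun Z hZ => by simp [hc, hZ]) ?_
      intro i hi φ hφ
      rw [hpair _ (by simpa [hi] using radonR_mem hφ.1 (m - i))]
      refine hlN ?_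
      exact Submodule.mem_iSup_of_mem i (Submodule.mem_iSup_of_mem
        (Finset.mem_range.mpr (by omega)) (Submodule.mem_map_of_mem hφ))
    apply hl
    rw [← hpair f hf, hc0]
    simp
  rw [hN, Submodule.mem_iSup_finset_iff_exists_sum] at hNM
  obtain ⟨μ, hμ⟩ := hNM
  choose φ hφ hφμ using fun i => Submodule.mem_map.mp (μ i).2
  refine ⟨fun i => ⟨φ i, hφ i⟩, ?_⟩
  rw [← hμ]
  exact Finset.sum_congr rfl (fun i _ => (hφμ i).symm)

/-! ### The action of the symmetric group -/

theorem permRep_apply (g : Equiv.Perm X) (f : Finset X → ℂ) (Z : Finset X) :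
    permRep X g f Z = f (Z.map g.symm.toEmbedding) := rfl

theorem radonDstar_permRep (g : Equiv.Perm X) (f : Finset X → ℂ) :
    radonDstar X (permRep X g f) = permRep X g (radonDstar X f) := by
  ext W
  rw [radonDstar_apply, permRep_apply, radonDstar_apply, Finset.sum_map]
  refine Finset.sum_congr rfl (fun x _ => ?_)
  rw [permRep_apply, Finset.map_erase]

theorem radonR_permRep (q : ℕ) (g : Equiv.Perm X) (f : Finset X → ℂ) :
    radonR X q (permRep X g f) = permRep X g (radonR X q f) := by
  have h : ∀ q, (radonDstar X ^ q) (permRep X g f) = permRep X g ((radonDstar X ^ q) f) := by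
    intro q
    induction q with
    | zero => rfl
    | succ q ih => rw [pow_succ', Module.End.mul_apply, ih, radonDstar_permRep]; rfl
  simp only [radonR, LinearMap.smul_apply, map_smul, h]

theorem sum_insert_erase_of_mem_spaceS {i : ℕ} {φ : Finset X → ℂ} (hφ : φ ∈ spaceS X i)
    {Z : Finset X} {x : X} (hx : x ∈ Z) :
    ∑ y ∈ Zᶜ, φ (insert y (Z.erase x)) = -φ Z := by
  have h : radonD X φ (Z.erase x) = 0 := congrFun (LinearMap.mem_ker.mp hφ.2) _
  rw [radonD_apply, Finset.compl_erase, Finset.sum_insert (by simpa using hx),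
    Finset.insert_erase hx] at h
  linear_combination h

theorem map_swap_of_mem_of_mem {Z : Finset X} {x y : X} (h : x ∈ Z ↔ y ∈ Z) :
    Z.map (Equiv.swap x y).symm.toEmbedding = Z := by
  ext z
  simp only [Finset.mem_map_equiv, Equiv.symm_symm]
  rcases eq_or_ne z x with rfl | hx
  · rw [Equiv.swap_apply_left, h]
  rcases eq_or_ne z y with rfl | hy
  · rw [Equiv.swap_apply_right, h]
  rw [Equiv.swap_apply_of_ne_of_ne hx hy]

theorem map_swap_of_mem_of_notMem {Z : Finset X} {x y : X} (hx : x ∈ Z) (hy : y ∉ Z) :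
    Z.map (Equiv.swap x y).symm.toEmbedding = insert y (Z.erase x) := by
  ext z
  simp only [Finset.mem_map_equiv, Equiv.symm_symm, Finset.mem_insert, Finset.mem_erase]
  have hxy : x ≠ y := ne_of_mem_of_not_mem hx hy
  rcases eq_or_ne z x with rfl | hzx
  · rw [Equiv.swap_apply_left]
    simp [hy, hxy]
  rcases eq_or_ne z y with rfl | hzy
  · rw [Equiv.swap_apply_right]
    simp [hx]
  rw [Equiv.swap_apply_of_ne_of_ne hzx hzy]
  simp [hzx, hzy]

/-- The scalar by which the sum of all `swap x y`, over all ordered pairs `(x, y)`, acts on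
`S^{t-i,i}`. -/
noncomputable def swapScalar (t i : ℕ) : ℂ := (i : ℂ) ^ 2 + ((t : ℂ) - i) ^ 2 - 2 * i

/-- A swap of `x ∈ Z` and `y ∉ Z` turns `Z` into `(Z \ {x}) ∪ {y}`, and for fixed `x` the sum of `φ`
over these sets is `-φ Z` since `d φ` vanishes at `Z \ {x}`. -/
theorem sum_swap_of_mem_spaceS {i : ℕ} {φ : Finset X → ℂ} (hφ : φ ∈ spaceS X i) :
    ∑ x, ∑ y, permRep X (Equiv.swap x y) φ = swapScalar (Fintype.card X) i • φ := by
  ext Z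
  by_cases hZ : Z.card = i
  swap
  · have h0 : ∀ g : Equiv.Perm X, permRep X g φ Z = 0 := fun g => hφ.1 _ (by simpa using hZ)
    simp [h0, hφ.1 Z hZ]
  have h1 : ∀ x ∈ Z, ∑ y, φ (Z.map (Equiv.swap x y).symm.toEmbedding)
      = (i : ℂ) * φ Z - φ Z := by
    intro x hx
    rw [← Finset.sum_add_sum_compl Z,
      Finset.sum_congr rfl (fun y hy => by
        rw [map_swap_of_mem_of_mem (iff_of_true hx hy)]),
      Finset.sum_congr (s₁ := Zᶜ) rfl (fun y hy => by
        rw [map_swap_of_mem_of_notMem hx (Finset.mem_compl.mp hy)]),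
      sum_insert_erase_of_mem_spaceS hφ hx, Finset.sum_const, hZ, nsmul_eq_mul]
    ring
  have h2 : ∑ x ∈ Zᶜ, ∑ y, φ (Z.map (Equiv.swap x y).symm.toEmbedding)
      = ((Fintype.card X : ℂ) - i) ^ 2 * φ Z - i * φ Z := by
    have h3 : ∀ x ∈ Zᶜ, ∑ y ∈ Zᶜ, φ (Z.map (Equiv.swap x y).symm.toEmbedding)
        = ((Fintype.card X : ℂ) - i) * φ Z := by
      intro x hx
      rw [Finset.sum_congr rfl (fun y hy => by
        rw [map_swap_of_mem_of_mem (iff_of_false (Finset.mem_compl.mp hx)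
          (Finset.mem_compl.mp hy))]), Finset.sum_const, Finset.card_compl, nsmul_eq_mul,
        Nat.cast_sub (Finset.card_le_univ Z), hZ]
    have h4 : ∀ y ∈ Z, ∑ x ∈ Zᶜ, φ (Z.map (Equiv.swap x y).symm.toEmbedding) = -φ Z := by
      intro y hy
      rw [← sum_insert_erase_of_mem_spaceS hφ hy]
      refine Finset.sum_congr rfl (fun x hx => ?_)
      rw [Equiv.swap_comm, map_swap_of_mem_of_notMem hy (Finset.mem_compl.mp hx)]
    simp only [← Finset.sum_add_sum_compl Z (fun y => φ (Z.map (Equiv.swap _ y).symm.toEmbedding))]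
    rw [Finset.sum_add_distrib, Finset.sum_congr rfl h3, Finset.sum_comm,
      Finset.sum_congr rfl h4, Finset.sum_const, Finset.sum_const, Finset.card_compl,
      nsmul_eq_mul, nsmul_eq_mul, Nat.cast_sub (Finset.card_le_univ Z), hZ]
    ring
  simp only [Finset.sum_apply, permRep_apply, Pi.smul_apply, smul_eq_mul]
  rw [← Finset.sum_add_sum_compl Z, Finset.sum_congr rfl h1, h2, Finset.sum_const, hZ,
    nsmul_eq_mul, swapScalar]
  ring

theorem swapScalar_injOn {t i j : ℕ} (hi : 2 * i ≤ t) (hj : 2 * j ≤ t)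
    (h : swapScalar t i = swapScalar t j) : i = j := by
  have h1 : ((i : ℂ) - j) * ((i : ℂ) + j - t - 1) = 0 := by
    rw [swapScalar, swapScalar] at h
    linear_combination h / 2
  rcases mul_eq_zero.mp h1 with h2 | h2
  · exact_mod_cast sub_eq_zero.mp h2
  · have h3 : ((i + j : ℕ) : ℂ) = ((t + 1 : ℕ) : ℂ) := by
      push_cast
      linear_combination h2
    have : i + j = t + 1 := by exact_mod_cast h3
    omega

/-! ### Zonal functions -/

/-- The zonal function at `Y` in `S^{t-k,k}`, where `k = |Y|`: up to a factor, the only function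
there that is fixed by the stabilizer of `Y`. -/
noncomputable def zonal (Y : Finset X) : Finset X → ℂ := fun Z =>
  if Z.card = Y.card then
    (-1) ^ (Z \ Y).card / ((Fintype.card X - Y.card).choose (Z \ Y).card : ℂ) else 0

theorem zonal_self (Y : Finset X) : zonal Y Y = 1 := by
  simp [zonal]

theorem zonal_comm (Y Z : Finset X) : zonal Y Z = zonal Z Y := by
  unfold zonal
  by_cases h : Z.card = Y.card
  · rw [if_pos h, if_pos h.symm, Finset.card_sdiff_comm h, h]
  · rw [if_neg h, if_neg (fun h' => h h'.symm)]

theorem star_zonal (Y Z : Finset X) : star (zonal Y Z) = zonal Y Z := by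
  unfold zonal
  split_ifs <;> simp

theorem permRep_zonal (g : Equiv.Perm X) (Y : Finset X) :
    permRep X g (zonal Y) = zonal (Y.map g.toEmbedding) := by
  ext Z
  have h : (Z.map g.symm.toEmbedding \ Y).card = (Z \ Y.map g.toEmbedding).card := by
    rw [← Finset.card_map g.toEmbedding, Finset.map_sdiff]
    congr 2
    ext x
    simp
  simp only [permRep_apply, zonal, Finset.card_map, h]

/-- At a `(k-1)`-set `W` with `r` points outside `Y`, the equation `d f = 0` for `f Z = F |Z \ Y|`
reads `(r + 1) F r + (t - k - r) F (r + 1) = 0`, which the zonal function solves. -/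
theorem zonal_mem_spaceS {Y : Finset X} (hY : 2 * Y.card ≤ Fintype.card X) :
    zonal Y ∈ spaceS X Y.card := by
  refine ⟨fun Z hZ => if_neg hZ, ?_⟩
  rw [SetLike.mem_coe, LinearMap.mem_ker]
  ext W
  rw [radonD_apply, Pi.zero_apply]
  by_cases hW : W.card + 1 = Y.card
  swap
  · refine Finset.sum_eq_zero (fun y hy => if_neg ?_)
    rw [Finset.card_insert_of_notMem (Finset.mem_compl.mp hy)]
    exact hW
  set r := (W \ Y).card with hr
  set s := Fintype.card X - Y.card with hs
  -- the points outside `W` fall into those of `Y` and those outside `Y`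
  have h1 : ∀ y ∈ Y \ W, zonal Y (insert y W) = (-1) ^ r / (s.choose r : ℂ) := by
    intro y hy
    rw [Finset.mem_sdiff] at hy
    rw [zonal, if_pos (by rw [Finset.card_insert_of_notMem hy.2, hW]),
      Finset.insert_sdiff_of_mem _ hy.1]
  have h2 : ∀ y ∈ Wᶜ \ Y, zonal Y (insert y W) = (-1) ^ (r + 1) / (s.choose (r + 1) : ℂ) := by
    intro y hy
    rw [Finset.mem_sdiff, Finset.mem_compl] at hy
    rw [zonal, if_pos (by rw [Finset.card_insert_of_notMem hy.1, hW]),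
      Finset.insert_sdiff_of_notMem _ hy.2, Finset.card_insert_of_notMem
        (fun h => hy.1 (Finset.mem_sdiff.mp h).1)]
  have hYW : (Y \ W).card = r + 1 := by
    have e1 := Finset.card_sdiff_add_card_inter W Y
    have e2 := Finset.card_sdiff_add_card_inter Y W
    rw [Finset.inter_comm] at e2
    omega
  have hWY : (Wᶜ \ Y).card = s - r := by
    have e1 : Wᶜ \ Y = Yᶜ \ (W \ Y) := by
      ext x
      simp only [Finset.mem_sdiff, Finset.mem_compl]
      tauto
    rw [e1, Finset.card_sdiff_of_subset, Finset.card_compl]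
    intro x hx
    exact Finset.mem_compl.mpr (Finset.mem_sdiff.mp hx).2
  have e : Wᶜ = (Y \ W) ∪ (Wᶜ \ Y) := by
    ext x
    simp only [Finset.mem_sdiff, Finset.mem_compl, Finset.mem_union]
    tauto
  have hdisj : Disjoint (Y \ W) (Wᶜ \ Y) := by
    rw [Finset.disjoint_left]
    intro x hx hx'
    exact (Finset.mem_sdiff.mp hx').2 (Finset.mem_sdiff.mp hx).1
  rw [e, Finset.sum_union hdisj, Finset.sum_congr rfl h1, Finset.sum_congr rfl h2,
    Finset.sum_const, Finset.sum_const, hYW, hWY, nsmul_eq_mul, nsmul_eq_mul]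
  have hrs : r + 1 ≤ s := by
    have : r ≤ W.card := Finset.card_le_card Finset.sdiff_subset
    omega
  have c1 : (s.choose r : ℂ) ≠ 0 := by
    exact_mod_cast (Nat.choose_pos (by omega)).ne'
  have c2 : (s.choose (r + 1) : ℂ) ≠ 0 := by
    exact_mod_cast (Nat.choose_pos hrs).ne'
  have c3 : (s.choose (r + 1) : ℂ) * (r + 1 : ℕ) = s.choose r * (s - r : ℕ) := by
    exact_mod_cast Nat.choose_succ_right_eq s r
  field_simp
  linear_combination (-1) ^ r * c3

/-- A function in `S^{t-k,k}` fixed by the stabilizer of the `k`-set `Y` and zero at `Y` vanishes: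
the equation `d F = 0` propagates the zero to the sets farther and farther from `Y`. -/
theorem eq_zero_of_stabilizer_fixed {k : ℕ} {F : Finset X → ℂ} (hF : F ∈ spaceS X k)
    {Y : Finset X} (hY : Y.card = k)
    (hfix : ∀ g : Equiv.Perm X, Y.map g.toEmbedding = Y → permRep X g F = F) (h0 : F Y = 0) :
    F = 0 := by
  have key : ∀ r : ℕ, ∀ Z : Finset X, Z.card = k → (Z \ Y).card = r → F Z = 0 := by
    intro r
    induction r with
    | zero =>
      intro Z hZ hr
      rw [Finset.card_eq_zero, Finset.sdiff_eq_empty_iff_subset] at hr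
      rwa [Finset.eq_of_subset_of_card_le hr (by omega)]
    | succ r ih =>
      intro Z hZ hr
      obtain ⟨x, hx⟩ : (Z \ Y).Nonempty := by
        rw [← Finset.card_pos]
        omega
      have hx' := Finset.mem_sdiff.mp hx
      have hsum := sum_insert_erase_of_mem_spaceS hF hx'.1
      have hterm : ∀ y ∈ Zᶜ, F (insert y (Z.erase x)) = if y ∈ Y then 0 else F Z := by
        intro y hy
        rw [Finset.mem_compl] at hy
        split_ifs with hyY
        · refine ih _ ?_ ?_
          · rw [Finset.card_insert_of_notMem (fun h => hy (Finset.mem_of_mem_erase h)),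
              Finset.card_erase_of_mem hx'.1]
            have := Finset.card_pos.mpr ⟨x, hx'.1⟩
            omega
          · rw [Finset.insert_sdiff_of_mem _ hyY, Finset.erase_sdiff_comm,
              Finset.card_erase_of_mem hx]
            omega
        · have := hfix (Equiv.swap x y)
            (by simpa using map_swap_of_mem_of_mem (iff_of_false hx'.2 hyY))
          rw [← map_swap_of_mem_of_notMem hx'.1 hy]
          exact congrFun this Z
      rw [Finset.sum_congr rfl hterm, Finset.sum_ite, Finset.sum_const_zero, zero_add,
        Finset.sum_const, nsmul_eq_mul] at hsum
      set N := (Zᶜ.filter (fun y => y ∉ Y)).card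
      have h1 : ((N + 1 : ℕ) : ℂ) * F Z = 0 := by
        push_cast
        linear_combination hsum
      exact (mul_eq_zero.mp h1).resolve_left (by exact_mod_cast Nat.succ_ne_zero N)
  ext Z
  by_cases hZ : Z.card = k
  · exact key _ Z hZ rfl
  · exact hF.1 Z hZ

/-- The stabilizer of a subset in the symmetric group, as a finite set of permutations. -/
def stab (Y : Finset X) : Finset (Equiv.Perm X) :=
  Finset.univ.filter (fun g => Y.map g.toEmbedding = Y)

theorem mem_stab {Y : Finset X} {g : Equiv.Perm X} :
    g ∈ stab Y ↔ Y.map g.toEmbedding = Y := by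
  simp [stab]

theorem card_stab_ne_zero (Y : Finset X) : ((stab Y).card : ℂ) ≠ 0 := by
  have : 0 < (stab Y).card := Finset.card_pos.mpr ⟨1, by
    rw [mem_stab]
    exact Finset.map_refl⟩
  exact_mod_cast this.ne'

theorem map_mul_toEmbedding (g g' : Equiv.Perm X) (Y : Finset X) :
    Y.map (g * g').toEmbedding = (Y.map g'.toEmbedding).map g.toEmbedding := by
  rw [Finset.map_map]
  rfl

theorem permRep_sum_stab {Y : Finset X} {g : Equiv.Perm X} (hg : Y.map g.toEmbedding = Y)
    (f : Finset X → ℂ) :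
    permRep X g (∑ g' ∈ stab Y, permRep X g' f) = ∑ g' ∈ stab Y, permRep X g' f := by
  rw [map_sum]
  refine Finset.sum_equiv (Equiv.mulLeft g) (fun g' => ?_) (fun g' _ => ?_)
  · rw [mem_stab, mem_stab, Equiv.coe_mulLeft, map_mul_toEmbedding]
    conv_rhs => rhs; rw [← hg]
    exact (Finset.map_injective g.toEmbedding).eq_iff.symm
  · rw [Equiv.coe_mulLeft, map_mul, Module.End.mul_apply]

theorem map_symm_of_map {Y : Finset X} {g : Equiv.Perm X} (hg : Y.map g.toEmbedding = Y) :
    Y.map g.symm.toEmbedding = Y := by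
  conv_lhs => rw [← hg]
  ext x
  simp

/-- The sum of a function of `S^{t-k,k}` over the stabilizer of `Y` is a multiple of the zonal
function. -/
theorem sum_stab_eq {Y : Finset X} (hY : 2 * Y.card ≤ Fintype.card X) {f : Finset X → ℂ}
    (hf : f ∈ spaceS X Y.card) :
    ∑ g ∈ stab Y, permRep X g f = (((stab Y).card : ℂ) * f Y) • zonal Y := by
  rw [← sub_eq_zero]
  refine eq_zero_of_stabilizer_fixed (k := Y.card) ?_ rfl ?_ ?_
  · exact Submodule.sub_mem _ (Submodule.sum_mem _ (fun g _ => spaceS_le_comap _ g hf))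
      (Submodule.smul_mem _ _ (zonal_mem_spaceS hY))
  · intro g hg
    rw [map_sub, permRep_sum_stab hg, map_smul, permRep_zonal, hg]
  · rw [Pi.sub_apply, Finset.sum_apply, Pi.smul_apply, zonal_self,
      Finset.sum_congr rfl (fun g hg => by
        rw [permRep_apply, map_symm_of_map (mem_stab.mp hg)]), Finset.sum_const]
    simp

theorem exists_perm_map_eq {Y Z : Finset X} (h : Y.card = Z.card) :
    ∃ g : Equiv.Perm X, Y.map g.toEmbedding = Z := by
  obtain ⟨e⟩ : Nonempty ({x // x ∈ Y} ≃ {x // x ∈ Z}) := ⟨Fintype.equivOfCardEq (by simpa using h)⟩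
  refine ⟨e.extendSubtype, ?_⟩
  refine Finset.eq_of_subset_of_card_le (fun z hz => ?_) (by simp [h])
  obtain ⟨x, hx, rfl⟩ := Finset.mem_map.mp hz
  exact e.extendSubtype_mem x hx

/-- The pairing of functions on subsets is invariant. -/
theorem sum_permRep_mul (g : Equiv.Perm X) (f f' : Finset X → ℂ) :
    ∑ Z, permRep X g f Z * permRep X g f' Z = ∑ Z, f Z * f' Z :=
  Equiv.sum_comp (Equiv.finsetCongr g.symm) (fun Z => f Z * f' Z)

/-- The zonal functions are a reproducing kernel, so they span `S^{t-k,k}`. -/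
theorem mem_span_zonal {k : ℕ} (hk : 2 * k ≤ Fintype.card X) {f : Finset X → ℂ}
    (hf : f ∈ spaceS X k) :
    f ∈ Submodule.span ℂ (zonal '' {Y : Finset X | Y.card = k}) := by
  -- average `f` over the stabilizer of `Y`, which does not change its pairing with `zonal Y`
  have hrep : ∀ Y : Finset X, Y.card = k →
      ∑ Z, f Z * zonal Y Z = f Y * ∑ Z, zonal Y Z * zonal Y Z := by
    intro Y hY
    subst hY
    have h1 : ∑ g ∈ stab Y, ∑ Z, permRep X g f Z * zonal Y Z =
        (stab Y).card * ∑ Z, f Z * zonal Y Z := by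
      rw [← nsmul_eq_mul, ← Finset.sum_const]
      refine Finset.sum_congr rfl (fun g hg => ?_)
      rw [← sum_permRep_mul g f, permRep_zonal, mem_stab.mp hg]
    rw [Finset.sum_comm] at h1
    simp only [← Finset.sum_mul, ← Finset.sum_apply, sum_stab_eq hk hf] at h1
    refine mul_left_cancel₀ (card_stab_ne_zero Y) ?_
    rw [← h1, Finset.mul_sum, Finset.mul_sum]
    refine Finset.sum_congr rfl (fun Z _ => ?_)
    rw [Pi.smul_apply, smul_eq_mul]
    ring
  obtain ⟨Y₀, -, hY₀⟩ : ∃ Y₀ ⊆ (Finset.univ : Finset X), Y₀.card = k :=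
    Finset.exists_subset_card_eq (by rw [Finset.card_univ]; omega)
  set c := ∑ Z, zonal Y₀ Z * zonal Y₀ Z with hc
  have hcY : ∀ Y : Finset X, Y.card = k → ∑ Z, zonal Y Z * zonal Y Z = c := by
    intro Y hY
    obtain ⟨g, rfl⟩ := exists_perm_map_eq (hY₀.trans hY.symm)
    rw [← permRep_zonal, sum_permRep_mul]
  have hc0 : c ≠ 0 := by
    intro h
    have h1 : zonal Y₀ = 0 := by
      refine eq_zero_of_sum_star_mul_self ?_
      rw [← h, hc]
      exact Finset.sum_congr rfl (fun Z _ => by rw [star_zonal])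
    have h2 := zonal_self Y₀
    rw [h1] at h2
    simp at h2
  have hfc : f = c⁻¹ • ∑ Z, f Z • zonal Z := by
    rw [eq_inv_smul_iff₀ hc0]
    ext Y
    rw [Pi.smul_apply, Finset.sum_apply]
    simp only [Pi.smul_apply, smul_eq_mul, zonal_comm _ Y]
    by_cases hY : Y.card = k
    · rw [hrep Y hY, hcY Y hY, mul_comm]
    · rw [hf.1 Y hY, mul_zero]
      symm
      refine Finset.sum_eq_zero (fun Z _ => ?_)
      by_cases hZ : Z.card = k
      · rw [zonal, if_neg (by omega), mul_zero]
      · rw [hf.1 Z hZ, zero_mul]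
  rw [hfc]
  refine Submodule.smul_mem _ _ (Submodule.sum_mem _ (fun Z _ => ?_))
  by_cases hZ : Z.card = k
  · exact Submodule.smul_mem _ _ (Submodule.subset_span ⟨Z, hZ, rfl⟩)
  · rw [hf.1 Z hZ, zero_smul]
    exact Submodule.zero_mem _

end Radon

section Blocks

variable {n h : ℕ}

/-! ### Functions on subsets of a union of two blocks -/

theorem card_blockA (hh : h ≤ n) : Fintype.card (BlockA n h) = h := by
  rw [Fintype.card_subtype]
  have : (Finset.univ.filter (inA n h)) = Finset.univ.map (Fin.castLEEmb hh) := by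
    ext x
    simp only [Finset.mem_filter, Finset.mem_univ, true_and, Finset.mem_map, inA]
    exact ⟨fun hx => ⟨⟨x, hx⟩, by ext; rfl⟩, fun ⟨y, hy⟩ => hy ▸ y.2⟩
  rw [this]
  simp

theorem card_blockB (hh : h ≤ n) : Fintype.card (BlockB n h) = n - h := by
  rw [Fintype.card_subtype_compl, Fintype.card_fin]
  congr 1
  exact card_blockA hh

/-- A subset of the whole set is the same as a pair of subsets of the blocks. -/
def splitEquiv (n h : ℕ) :
    Finset (Fin n) ≃ Finset (BlockA n h) × Finset (BlockB n h) where
  toFun Z := (Z.subtype _, Z.subtype _)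
  invFun p := p.1.map (Function.Embedding.subtype _) ∪ p.2.map (Function.Embedding.subtype _)
  left_inv Z := by
    ext x
    by_cases hx : inA n h x
    · simp [hx]
    · simpa [hx] using fun _ => not_lt.mp hx
  right_inv p := by
    ext x
    · have := x.2
      simp [this]
    · have := x.2
      simpa [this] using fun _ => not_lt.mp this

theorem splitEquiv_apply (Z : Finset (Fin n)) :
    splitEquiv n h Z = (Z.subtype (inA n h), Z.subtype (fun x => ¬ inA n h x)) := rfl

theorem card_split (Z : Finset (Fin n)) :
    (Z.subtype (inA n h)).card + (Z.subtype (fun x => ¬ inA n h x)).card = Z.card := by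
  rw [Finset.card_subtype, Finset.card_subtype, Finset.card_filter_add_card_filter_not]

theorem sum_split (s : Finset (Fin n)) (F : Fin n → ℂ) :
    ∑ x ∈ s, F x = ∑ a ∈ s.subtype (inA n h), F a
      + ∑ b ∈ s.subtype (fun x => ¬ inA n h x), F b := by
  rw [Finset.sum_subtype_eq_sum_filter, Finset.sum_subtype_eq_sum_filter,
    Finset.sum_filter_add_sum_filter_not]

theorem box_apply (φ : Finset (BlockA n h) → ℂ) (ψ : Finset (BlockB n h) → ℂ)
    (Z : Finset (Fin n)) :
    box n h φ ψ Z = φ (splitEquiv n h Z).1 * ψ (splitEquiv n h Z).2 := rfl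

/-- The bilinear map `(φ, ψ) ↦ φ ⊗ ψ` with values in the functions on subsets of the whole set. -/
noncomputable def boxHom (n h : ℕ) : (Finset (BlockA n h) → ℂ) →ₗ[ℂ] (Finset (BlockB n h) → ℂ) →ₗ[ℂ]
    (Finset (Fin n) → ℂ) :=
  LinearMap.mk₂ ℂ (box n h)
    (fun _ _ _ => by ext; simp [box, add_mul])
    (fun _ _ _ => by ext; simp [box, mul_assoc])
    (fun _ _ _ => by ext; simp [box, mul_add])
    (fun _ _ _ => by ext; simp [box, mul_left_comm])

theorem boxHom_apply (φ : Finset (BlockA n h) → ℂ) (ψ : Finset (BlockB n h) → ℂ) :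
    boxHom n h φ ψ = box n h φ ψ := rfl

theorem dirac_eq_box (Z : Finset (Fin n)) :
    dirac Z = box n h (dirac (splitEquiv n h Z).1) (dirac (splitEquiv n h Z).2) := by
  ext W
  rw [box_apply]
  simp only [dirac, Pi.single_apply, ← ite_and, mul_ite, mul_one, mul_zero]
  have : (W = Z) ↔ ((splitEquiv n h W).2 = (splitEquiv n h Z).2 ∧
      (splitEquiv n h W).1 = (splitEquiv n h Z).1) := by
    rw [and_comm, ← Prod.ext_iff, (splitEquiv n h).injective.eq_iff]
  simp only [this]

/-- All Dirac functions are in the image, and the dimensions agree. -/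
theorem lift_boxHom_injective : Function.Injective (TensorProduct.lift (boxHom n h)) := by
  rw [LinearMap.injective_iff_surjective_of_finrank_eq_finrank]
  · rw [← LinearMap.range_eq_top, eq_top_iff, ← (Pi.basisFun ℂ (Finset (Fin n))).span_eq,
      Submodule.span_le]
    rintro _ ⟨Z, rfl⟩
    rw [Pi.basisFun_apply]
    change dirac Z ∈ _
    rw [dirac_eq_box (h := h)]
    exact ⟨_ ⊗ₜ _, TensorProduct.lift.tmul _ _⟩
  · rw [Module.finrank_tensorProduct, Module.finrank_fintype_fun_eq_card,
      Module.finrank_fintype_fun_eq_card, Module.finrank_fintype_fun_eq_card,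
      Fintype.card_congr (splitEquiv n h), Fintype.card_prod]

/-- The Leibniz rule for `d`. -/
theorem radonD_box (φ : Finset (BlockA n h) → ℂ) (ψ : Finset (BlockB n h) → ℂ) :
    radonD (Fin n) (box n h φ ψ) =
      box n h (radonD _ φ) ψ + box n h φ (radonD _ ψ) := by
  ext W
  rw [radonD_apply, sum_split (h := h), Pi.add_apply]
  congr 1
  · rw [box, radonD_apply, Finset.sum_mul]
    refine Finset.sum_congr (by ext; simp) (fun a _ => ?_)
    rw [box]
    congr 2
    · ext x
      simp [Subtype.ext_iff]
    · ext x
      have : (x : Fin n) ≠ a := fun e => x.2 (e ▸ a.2)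
      simp [this]
  · rw [box, radonD_apply, Finset.mul_sum]
    refine Finset.sum_congr (by ext; simp) (fun b _ => ?_)
    rw [box]
    congr 2
    · ext x
      have : (x : Fin n) ≠ b := fun e => b.2 (e ▸ x.2)
      simp [this]
    · ext x
      simp [Subtype.ext_iff]

theorem youngHom_apply_left (g : Young n h) (a : BlockA n h) :
    youngHom n h g a = g.1 a :=
  Equiv.Perm.subtypeCongr.left_apply_subtype _ _ a

theorem youngHom_apply_right (g : Young n h) (b : BlockB n h) :
    youngHom n h g b = g.2 b :=
  Equiv.Perm.subtypeCongr.right_apply_subtype _ _ b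

theorem permRep_box (g : Young n h) (φ : Finset (BlockA n h) → ℂ)
    (ψ : Finset (BlockB n h) → ℂ) :
    permRep (Fin n) (youngHom n h g) (box n h φ ψ) =
      box n h (permRep _ g.1 φ) (permRep _ g.2 ψ) := by
  ext Z
  simp only [permRep_apply, box]
  congr 2
  · ext a
    simp [Finset.mem_map_equiv, youngHom_apply_left]
  · ext b
    simp [Finset.mem_map_equiv, youngHom_apply_right]

/-- The representation of `S_h × S_{n-h}` on all functions on subsets. -/
noncomputable def youngRep (n h : ℕ) : Representation ℂ (Young n h) (Finset (Fin n) → ℂ) :=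
  (permRep (Fin n)).comp (youngHom n h)

theorem youngRep_apply (g : Young n h) (f : Finset (Fin n) → ℂ) :
    youngRep n h g f = permRep (Fin n) (youngHom n h g) f := rfl

/-! ### Products of strings -/

/-- The linear map `φ ⊗ ψ ↦ (R_q φ) ⊗ (R_r ψ)` on `S^{h-i,i}(A) ⊗ S^{n-h-j,j}(B)`. -/
noncomputable def boxR (n h i j q r : ℕ) : SS n h i j →ₗ[ℂ] (Finset (Fin n) → ℂ) :=
  TensorProduct.lift (boxHom n h) ∘ₗ
    TensorProduct.map (radonR (BlockA n h) q ∘ₗ (spaceS (BlockA n h) i).subtype)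
      (radonR (BlockB n h) r ∘ₗ (spaceS (BlockB n h) j).subtype)

variable {i j : ℕ}

theorem boxR_tmul (q r : ℕ) (φ : spaceS (BlockA n h) i) (ψ : spaceS (BlockB n h) j) :
    boxR n h i j q r (φ ⊗ₜ ψ) =
      box n h (radonR (BlockA n h) q φ) (radonR (BlockB n h) r ψ) := rfl

theorem boxR_apply_eq_zero {q r : ℕ} (t : SS n h i j) {Z : Finset (Fin n)}
    (hZ : (Z.subtype (inA n h)).card ≠ i + q ∨
      (Z.subtype (fun x => ¬ inA n h x)).card ≠ j + r) :
    boxR n h i j q r t Z = 0 := by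
  induction t using TensorProduct.induction_on with
  | zero => simp
  | add t t' ht ht' => rw [map_add, Pi.add_apply, ht, ht', add_zero]
  | tmul φ ψ =>
    rw [boxR_tmul, box]
    rcases hZ with hZ | hZ
    · rw [radonR_mem φ.2.1 q _ hZ, zero_mul]
    · rw [radonR_mem ψ.2.1 r _ hZ, mul_zero]

theorem boxR_mem_funM {q r : ℕ} (t : SS n h i j) :
    boxR n h i j q r t ∈ funM (Fin n) (i + q + (j + r)) := by
  intro Z hZ
  refine boxR_apply_eq_zero t ?_
  have := card_split (h := h) Z
  omega

theorem boxR_repSS (q r : ℕ) (g : Young n h) (t : SS n h i j) :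
    boxR n h i j q r (repSS n h i j g t) = youngRep n h g (boxR n h i j q r t) := by
  induction t using TensorProduct.induction_on with
  | zero => simp
  | add t t' ht ht' => simp only [map_add, ht, ht']
  | tmul φ ψ =>
    rw [boxR_tmul, youngRep_apply, permRep_box, ← radonR_permRep, ← radonR_permRep]
    rfl

theorem boxR_injective {q r : ℕ} (hh : h ≤ n) (hq : 2 * i + q ≤ h) (hr : 2 * j + h + r ≤ n) :
    Function.Injective (boxR n h i j q r) := by
  refine lift_boxHom_injective.comp (TensorProduct.map_injective_of_flat_flat _ _ ?_ ?_)
  · rw [injective_iff_map_eq_zero]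
    intro φ hφ
    exact Subtype.ext (eq_zero_of_radonR_eq_zero φ.2 (by rw [card_blockA hh]; omega) hφ)
  · rw [injective_iff_map_eq_zero]
    intro φ hφ
    exact Subtype.ext (eq_zero_of_radonR_eq_zero φ.2 (by rw [card_blockB hh]; omega) hφ)

theorem boxR_eq_zero {q r : ℕ} (hh : h ≤ n) (hqr : h < 2 * i + q ∨ n < 2 * j + h + r)
    (t : SS n h i j) : boxR n h i j q r t = 0 := by
  induction t using TensorProduct.induction_on with
  | zero => simp
  | add t t' ht ht' => rw [map_add, ht, ht', add_zero]
  | tmul φ ψ =>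
    rw [boxR_tmul, ← boxHom_apply]
    rcases hqr with hq | hr
    · rw [radonR_eq_zero φ.2 (by rw [card_blockA hh]; omega), map_zero, LinearMap.zero_apply]
    · rw [radonR_eq_zero ψ.2 (by rw [card_blockB hh]; omega), map_zero]

/-- The part of `d (R_q ⊗ R_r) t` that comes from `d` acting on the factor of `A`. The case
distinction avoids `q - 1` at the bottom `q = 0` of the string, which `d` kills. -/
noncomputable def dLeft (n h i j q r : ℕ) (t : SS n h i j) : Finset (Fin n) → ℂ :=
  match q with
  | 0 => 0
  | q + 1 => ((h : ℂ) - 2 * i - q) • boxR n h i j q r t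

/-- The part of `d (R_q ⊗ R_r) t` that comes from `d` acting on the factor of `B`. -/
noncomputable def dRight (n h i j q r : ℕ) (t : SS n h i j) : Finset (Fin n) → ℂ :=
  match r with
  | 0 => 0
  | r + 1 => ((n : ℂ) - h - 2 * j - r) • boxR n h i j q r t

theorem radonD_boxR (hh : h ≤ n) (q r : ℕ) (t : SS n h i j) :
    radonD (Fin n) (boxR n h i j q r t) = dLeft n h i j q r t + dRight n h i j q r t := by
  induction t using TensorProduct.induction_on with
  | zero => cases q <;> cases r <;> simp [dLeft, dRight]
  | add t t' ht ht' =>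
    rw [map_add, map_add, ht, ht']
    cases q <;> cases r <;> simp only [dLeft, dRight, map_add, smul_add] <;> abel
  | tmul φ ψ =>
    rw [boxR_tmul, radonD_box]
    congr 1
    · rw [← boxHom_apply]
      cases q with
      | zero => simp [dLeft, radonR_zero, LinearMap.mem_ker.mp φ.2.2]
      | succ q =>
        rw [radonD_radonR_succ φ.2, map_smul, LinearMap.smul_apply, card_blockA hh]
        rfl
    · rw [← boxHom_apply]
      cases r with
      | zero => simp [dRight, radonR_zero, LinearMap.mem_ker.mp ψ.2.2]
      | succ r =>
        rw [radonD_radonR_succ ψ.2, map_smul, card_blockB hh, Nat.cast_sub hh]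
        rfl

/-- The function `∑ (R_{m-p} ⊗ R_p) t_p`, summed over `0 ≤ p ≤ m`, for a sequence `t` in
`S^{h-i,i}(A) ⊗ S^{n-h-j,j}(B)`. -/
noncomputable def stringSum (n h i j m : ℕ) (t : ℕ → SS n h i j) : Finset (Fin n) → ℂ :=
  ∑ p ∈ Finset.range (m + 1), boxR n h i j (m - p) p (t p)

theorem stringSum_mem_funM {m : ℕ} (t : ℕ → SS n h i j) :
    stringSum n h i j m t ∈ funM (Fin n) (i + j + m) := by
  refine Submodule.sum_mem _ (fun p hp => ?_)
  have hp' := Finset.mem_range.mp hp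
  have := boxR_mem_funM (q := m - p) (r := p) (t p)
  rwa [show i + (m - p) + (j + p) = i + j + m by omega] at this

theorem radonD_stringSum_zero (hh : h ≤ n) (t : ℕ → SS n h i j) :
    radonD (Fin n) (stringSum n h i j 0 t) = 0 := by
  simp [stringSum, radonD_boxR hh, dLeft, dRight]

theorem radonD_stringSum_succ (hh : h ≤ n) (m : ℕ) (t : ℕ → SS n h i j) :
    radonD (Fin n) (stringSum n h i j (m + 1) t) =
      stringSum n h i j m (fun p => ((h : ℂ) - 2 * i - (m - p : ℕ)) • t p
        + ((n : ℂ) - h - 2 * j - p) • t (p + 1)) := by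
  rw [stringSum, map_sum]
  simp only [radonD_boxR hh]
  rw [Finset.sum_add_distrib, Finset.sum_range_succ, Finset.sum_range_succ' (n := m + 1)]
  simp only [Nat.sub_self, dLeft, dRight, add_zero]
  rw [← Finset.sum_add_distrib, stringSum]
  refine Finset.sum_congr rfl (fun p hp => ?_)
  have hp' := Finset.mem_range.mp hp
  rw [show m + 1 - p = m - p + 1 by omega, show m + 1 - (p + 1) = m - p by omega, map_add,
    map_smul, map_smul]

/-- The terms of a string sum have different degrees on the block `A`, so they vanish with it. -/
theorem stringSum_eq_zero_iff (hh : h ≤ n) {m : ℕ} (t : ℕ → SS n h i j) :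
    stringSum n h i j m t = 0 ↔
      ∀ p ≤ m, 2 * i + (m - p) ≤ h → 2 * j + h + p ≤ n → t p = 0 := by
  constructor
  · intro h0 p hp hq hr
    refine (injective_iff_map_eq_zero _).mp (boxR_injective hh hq hr) _ ?_
    ext Z
    by_cases hZ : (Z.subtype (inA n h)).card = i + (m - p)
    · have h1 : stringSum n h i j m t Z = boxR n h i j (m - p) p (t p) Z := by
        rw [stringSum, Finset.sum_apply]
        refine Finset.sum_eq_single p (fun p' hp' hne => ?_) (fun hp' => ?_)
        · have := Finset.mem_range.mp hp'
          exact boxR_apply_eq_zero _ (Or.inl (by omega))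
        · exact absurd (Finset.mem_range.mpr (by omega)) hp'
      rw [← h1, h0]
    · exact boxR_apply_eq_zero _ (Or.inl hZ)
  · intro h0
    refine Finset.sum_eq_zero (fun p hp => ?_)
    have hp' := Finset.mem_range.mp hp
    by_cases hqr : 2 * i + (m - p) ≤ h ∧ 2 * j + h + p ≤ n
    · rw [h0 p (by omega) hqr.1 hqr.2, map_zero]
    · exact boxR_eq_zero hh (by omega) _

theorem stringSum_repSS (m : ℕ) (g : Young n h) (t : ℕ → SS n h i j) :
    stringSum n h i j m (fun p => repSS n h i j g (t p)) =
      youngRep n h g (stringSum n h i j m t) := by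
  simp only [stringSum, map_sum, boxR_repSS]

/-- The equation `d ∑ (R_{m-p} ⊗ R_p) t_p = 0` as a two-term recursion. -/
theorem radonD_stringSum_eq_zero_iff (hh : h ≤ n) {m : ℕ} (t : ℕ → SS n h i j) :
    radonD (Fin n) (stringSum n h i j m t) = 0 ↔
      ∀ p < m, 2 * i + (m - 1 - p) ≤ h → 2 * j + h + p ≤ n →
        ((h : ℂ) - 2 * i - (m - 1 - p : ℕ)) • t p + ((n : ℂ) - h - 2 * j - p) • t (p + 1) = 0 := by
  cases m with
  | zero => simp [radonD_stringSum_zero hh]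
  | succ m =>
    rw [radonD_stringSum_succ hh, stringSum_eq_zero_iff hh]
    simp only [Nat.lt_succ_iff, Nat.add_sub_cancel]

end Blocks

/-! ### The coefficients -/

theorem poch_succ (x : ℤ) (k : ℕ) : poch x (k + 1) = poch x k * (x + k) :=
  Finset.prod_range_succ _ _

theorem poch_pos {x : ℤ} (hx : 0 < x) (k : ℕ) : 0 < poch x k :=
  Finset.prod_pos (fun t _ => by positivity)

theorem poch_neg_self (p : ℕ) : poch (-p) p = (-1) ^ p * p.factorial := by
  unfold poch
  rw [← Finset.prod_range_reflect]
  have : ∀ t ∈ Finset.range p, (-(p : ℤ) + ((p - 1 - t : ℕ) : ℤ)) = (-1) * ((t + 1 : ℕ) : ℤ) := by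
    intro t ht
    have := Finset.mem_range.mp ht
    omega
  rw [Finset.prod_congr rfl this, Finset.prod_mul_distrib, Finset.prod_const, Finset.card_range,
    ← Nat.cast_prod, Finset.prod_range_add_one_eq_factorial]

/-- When `c = m`, the sum that defines `E_m(a,b,c,p)` has the single term `j = p`. -/
theorem hahnE_self (a b : ℤ) (p q : ℕ) :
    hahnE (p + q) a b (p + q : ℕ) p =
      (-1) ^ q * (p + q).factorial * poch (b - (p + q : ℕ) + 1) p
        * poch (a - (p + q : ℕ) + 1) q := by
  unfold hahnE
  have h : (Finset.range (p + q + 1)).filter (fun j : ℕ =>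
      (p : ℤ) - (p + q : ℕ) + ((p + q : ℕ) : ℤ) ≤ (j : ℤ) ∧ (j : ℤ) ≤ p) = {p} := by
    ext j
    simp only [Finset.mem_filter, Finset.mem_range, Finset.mem_singleton]
    omega
  have hq : (p : ℤ) - ((p + q : ℕ) : ℤ) = -q := by push_cast; ring
  rw [h, Finset.sum_singleton, hq, Nat.add_sub_cancel_left, poch_neg_self, poch_neg_self,
    ← Nat.add_choose_mul_factorial_mul_factorial p q, Nat.choose_symm_add]
  have h1 : ((-1 : ℤ) ^ p) * (-1) ^ p = 1 := by rw [← mul_pow]; simp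
  push_cast
  linear_combination ((-1) ^ q * ((p + q).choose q) * p.factorial * q.factorial
    * poch (b - (p + q) + 1) p * poch (a - (p + q) + 1) q : ℤ) * h1

variable {n h k i j : ℕ}

theorem lrCoeff_add (hc : LRCond n h k i j) {p q : ℕ} (hpq : p + q = k - i - j) :
    lrCoeff n h k i j (j + p) = (((-1) ^ q * (p + q).factorial
      * poch ((h : ℤ) - 2 * i - (p + q : ℕ) + 1) p
      * poch ((n : ℤ) - h - 2 * j - (p + q : ℕ) + 1) q : ℤ) : ℂ) := by
  rw [← hahnE_self, lrCoeff, hpq]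
  have h1 : (k : ℤ) - i - j = ((k - i - j : ℕ) : ℤ) := by
    have := hc.2.2
    omega
  rw [h1, Nat.cast_add, add_sub_cancel_left]

theorem lrCoeff_ne_zero (hc : LRCond n h k i j) {p : ℕ} (hp : p ≤ k - i - j) :
    lrCoeff n h k i j (j + p) ≠ 0 := by
  obtain ⟨q, hq⟩ := Nat.exists_eq_add_of_le hp
  obtain ⟨h1, h2, h3⟩ := hc
  rw [lrCoeff_add ⟨h1, h2, h3⟩ hq.symm, Int.cast_ne_zero]
  have e1 := poch_pos (x := (h : ℤ) - 2 * i - (p + q : ℕ) + 1) (by omega) p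
  have e2 := poch_pos (x := (n : ℤ) - h - 2 * j - (p + q : ℕ) + 1) (by omega) q
  have e3 : ((p + q).factorial : ℤ) ≠ 0 := by exact_mod_cast (p + q).factorial_ne_zero
  have e4 : ((-1 : ℤ)) ^ q ≠ 0 := pow_ne_zero _ (by norm_num)
  exact mul_ne_zero (mul_ne_zero (mul_ne_zero e4 e3) e1.ne') e2.ne'

theorem lrCoeff_recursion (hc : LRCond n h k i j) {p : ℕ} (hp : p < k - i - j) :
    ((h : ℂ) - 2 * i - (k - i - j - 1 - p : ℕ)) * lrCoeff n h k i j (j + p)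
      + ((n : ℂ) - h - 2 * j - p) * lrCoeff n h k i j (j + (p + 1)) = 0 := by
  obtain ⟨q, hq⟩ := Nat.exists_eq_add_of_lt hp
  rw [lrCoeff_add hc (p := p) (q := q + 1) (by omega),
    lrCoeff_add hc (p := p + 1) (q := q) (by omega), poch_succ, poch_succ,
    show k - i - j - 1 - p = q by omega, show p + 1 + q = p + (q + 1) by omega]
  push_cast
  ring

/-! ### The two-term recursion -/

section Recursion

variable {T : Type} [AddCommGroup T] [Module ℂ T]

theorem coeffA_ne_zero {q : ℕ} (hq : 2 * i + q + 1 ≤ h) : (h : ℂ) - 2 * i - q ≠ 0 := by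
  have : (h : ℂ) - 2 * i - q = ((h - 2 * i - q : ℕ) : ℂ) := by
    rw [Nat.cast_sub (by omega), Nat.cast_sub (by omega)]
    push_cast
    ring
  rw [this, Nat.cast_ne_zero]
  omega

theorem coeffB_ne_zero {p : ℕ} (hp : 2 * j + h + p + 1 ≤ n) : (n : ℂ) - h - 2 * j - p ≠ 0 := by
  have : (n : ℂ) - h - 2 * j - p = ((n - h - 2 * j - p : ℕ) : ℂ) := by
    rw [Nat.cast_sub (by omega), Nat.cast_sub (by omega), Nat.cast_sub (by omega)]
    push_cast
    ring
  rw [this, Nat.cast_ne_zero]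
  omega

/-- Under the Littlewood-Richardson condition no coefficient of the recursion vanishes, and its
solutions are the multiples of the Hahn coefficients. -/
theorem recursion_iff_of_LRCond (hc : LRCond n h k i j) (t : ℕ → T) :
    (∀ p < k - i - j, 2 * i + (k - i - j - 1 - p) ≤ h → 2 * j + h + p ≤ n →
        ((h : ℂ) - 2 * i - (k - i - j - 1 - p : ℕ)) • t p
          + ((n : ℂ) - h - 2 * j - p) • t (p + 1) = 0) ↔
      ∃ s : T, ∀ p ≤ k - i - j, t p = lrCoeff n h k i j (j + p) • s := by
  constructor
  · intro H
    refine ⟨(lrCoeff n h k i j (j + 0))⁻¹ • t 0, fun p => ?_⟩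
    induction p with
    | zero =>
      intro _
      rw [smul_smul, mul_inv_cancel₀ (lrCoeff_ne_zero hc (Nat.zero_le _)), one_smul]
    | succ p ih =>
      intro hp
      obtain ⟨h1, h2, h3⟩ := hc
      have H1 := H p (by omega) (by omega) (by omega)
      have h4 := lrCoeff_recursion ⟨h1, h2, h3⟩ (p := p) (by omega)
      rw [ih (by omega), smul_smul, eq_neg_of_add_eq_zero_left h4, neg_smul, neg_add_eq_zero,
        mul_smul] at H1
      exact (smul_right_injective _ (coeffB_ne_zero (by omega)) H1).symm
  · rintro ⟨s, hs⟩ p hp _ _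
    rw [hs p (by omega), hs (p + 1) (by omega), smul_smul, smul_smul, ← add_smul,
      lrCoeff_recursion hc hp, zero_smul]

/-- If the Littlewood-Richardson condition fails, the recursion has a boundary equation with a
single term, at the lower end of the range if `k - i - j > h - 2 i` and at the upper end otherwise;
the zero then propagates through the range. -/
theorem eq_zero_of_recursion (hij : i + j ≤ k) (hc : ¬ LRCond n h k i j) (t : ℕ → T)
    (H : ∀ p < k - i - j, 2 * i + (k - i - j - 1 - p) ≤ h → 2 * j + h + p ≤ n →
        ((h : ℂ) - 2 * i - (k - i - j - 1 - p : ℕ)) • t p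
          + ((n : ℂ) - h - 2 * j - p) • t (p + 1) = 0) :
    ∀ p ≤ k - i - j, 2 * i + (k - i - j - p) ≤ h → 2 * j + h + p ≤ n → t p = 0 := by
  set m := k - i - j with hm
  by_cases hA : h < 2 * i + m
  · intro p
    induction p with
    | zero => omega
    | succ p ih =>
      intro hp hq hr
      have H1 := H p (by omega) (by omega) (by omega)
      have h0 : ((h : ℂ) - 2 * i - (m - 1 - p : ℕ)) • t p = 0 := by
        by_cases hq' : 2 * i + (m - p) ≤ h
        · rw [ih (by omega) hq' (by omega), smul_zero]
        · have : h = 2 * i + (m - 1 - p) := by omega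
          have h1 : (h : ℂ) = 2 * i + (m - 1 - p : ℕ) := by exact_mod_cast this
          rw [h1]
          simp
      rw [h0, zero_add] at H1
      exact (smul_eq_zero.mp H1).resolve_left (coeffB_ne_zero (by omega))
  · have hB : n < 2 * j + h + m := by
      by_contra hB
      exact hc ⟨by omega, by omega, hij⟩
    have key : ∀ d p, p ≤ m → 2 * j + h + p + d = n → t p = 0 := by
      intro d
      induction d with
      | zero =>
        intro p hp hd
        have H1 := H p (by omega) (by omega) (by omega)
        have h1 : (n : ℂ) = 2 * j + h + p := by exact_mod_cast hd.symm
        rw [show (n : ℂ) - h - 2 * j - p = 0 by rw [h1]; ring, zero_smul, add_zero] at H1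
        exact (smul_eq_zero.mp H1).resolve_left (coeffA_ne_zero (by omega))
      | succ d ih =>
        intro p hp hd
        have H1 := H p (by omega) (by omega) (by omega)
        rw [ih (p + 1) (by omega) (by omega), smul_zero, add_zero] at H1
        exact (smul_eq_zero.mp H1).resolve_left (coeffA_ne_zero (by omega))
    intro p hp _ hr
    exact key (n - (2 * j + h + p)) p hp (by omega)

end Recursion

/-! ### Solving `d ∑ α_l (R_{k-l-i} φ) ⊗ (R_{l-j} ψ) = 0` -/

theorem sum_Icc_eq_stringSum (hij : i + j ≤ k) (α : ℕ → ℂ)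
    (φ : spaceS (BlockA n h) i) (ψ : spaceS (BlockB n h) j) :
    ∑ l ∈ Finset.Icc j (k - i), α l • box n h (radonR (BlockA n h) (k - l - i) φ)
        (radonR (BlockB n h) (l - j) ψ) =
      stringSum n h i j (k - i - j) (fun p => α (j + p) • (φ ⊗ₜ ψ)) := by
  rw [stringSum]
  symm
  refine Finset.sum_bij' (fun p _ => j + p) (fun l _ => l - j) ?_ ?_ ?_ ?_ ?_
  · intro p hp
    rw [Finset.mem_range] at hp
    rw [Finset.mem_Icc]
    omega
  · intro l hl
    rw [Finset.mem_Icc] at hl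
    rw [Finset.mem_range]
    omega
  · intro p _
    omega
  · intro l hl
    rw [Finset.mem_Icc] at hl
    omega
  · intro p hp
    rw [map_smul, boxR_tmul, Nat.add_sub_cancel_left,
      show k - (j + p) - i = k - i - j - p by omega]

/-- Extending the range of summation to `j ≤ l ≤ k - i` only adds terms beyond the ends of the
strings, which are zero. -/
theorem sum_lRange_eq_stringSum (hh : h ≤ n) (hij : i + j ≤ k) (α : ℕ → ℂ)
    (φ : spaceS (BlockA n h) i) (ψ : spaceS (BlockB n h) j) :
    ∑ l ∈ lRange n h k i j, α l • box n h (radonR (BlockA n h) (k - l - i) φ)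
        (radonR (BlockB n h) (l - j) ψ) =
      stringSum n h i j (k - i - j) (fun p => α (j + p) • (φ ⊗ₜ ψ)) := by
  rw [← sum_Icc_eq_stringSum hij]
  refine Finset.sum_subset ?_ ?_
  · intro l hl
    rw [lRange, Finset.mem_filter] at hl
    rw [Finset.mem_Icc]
    omega
  · intro l hl hl'
    rw [Finset.mem_Icc] at hl
    rw [lRange, Finset.mem_filter, Finset.mem_range] at hl'
    rw [← boxR_tmul, boxR_eq_zero hh (by omega), smul_zero]

theorem tmul_ne_zero {φ : spaceS (BlockA n h) i} {ψ : spaceS (BlockB n h) j} (hφ : φ ≠ 0)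
    (hψ : ψ ≠ 0) : φ ⊗ₜ[ℂ] ψ ≠ 0 := by
  intro h0
  obtain ⟨Y, hY⟩ : ∃ Y, (φ : Finset (BlockA n h) → ℂ) Y ≠ 0 := by
    by_contra! hc
    exact hφ (Subtype.ext (funext hc))
  obtain ⟨Y', hY'⟩ : ∃ Y', (ψ : Finset (BlockB n h) → ℂ) Y' ≠ 0 := by
    by_contra! hc
    exact hψ (Subtype.ext (funext hc))
  have h1 := boxR_tmul 0 0 φ ψ
  rw [h0, map_zero, radonR_zero, radonR_zero] at h1
  have h2 := congrFun h1 ((splitEquiv n h).symm (Y, Y'))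
  rw [box_apply, Equiv.apply_symm_apply] at h2
  exact mul_ne_zero hY hY' h2.symm

theorem lRange_eq_Icc (hc : LRCond n h k i j) : lRange n h k i j = Finset.Icc j (k - i) := by
  obtain ⟨h1, h2, h3⟩ := hc
  ext l
  rw [lRange, Finset.mem_filter, Finset.mem_range, Finset.mem_Icc]
  omega

theorem radonD_sum_eq_zero_iff (hh : h ≤ n) (hc : LRCond n h k i j) (α : ℕ → ℂ)
    {φ : spaceS (BlockA n h) i} {ψ : spaceS (BlockB n h) j} (hφ : φ ≠ 0) (hψ : ψ ≠ 0) :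
    radonD (Fin n) (∑ l ∈ lRange n h k i j, α l • box n h (radonR (BlockA n h) (k - l - i) φ)
        (radonR (BlockB n h) (l - j) ψ)) = 0 ↔
      ∃ c : ℂ, ∀ l ∈ Finset.Icc j (k - i), α l = c * lrCoeff n h k i j l := by
  rw [sum_lRange_eq_stringSum hh hc.2.2, radonD_stringSum_eq_zero_iff hh]
  refine (recursion_iff_of_LRCond (T := SS n h i j) hc (fun p => α (j + p) • φ ⊗ₜ ψ)).trans ?_
  have hij := hc.2.2
  constructor
  · rintro ⟨s, hs⟩
    refine ⟨(lrCoeff n h k i j (j + 0))⁻¹ * α (j + 0), fun l hl => ?_⟩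
    rw [Finset.mem_Icc] at hl
    have h0 := hs 0 (Nat.zero_le _)
    have h1 := hs (l - j) (by omega)
    rw [show j + (l - j) = l by omega] at h1
    have h2 : s = ((lrCoeff n h k i j (j + 0))⁻¹ * α (j + 0)) • (φ ⊗ₜ[ℂ] ψ) := by
      rw [mul_smul, h0, smul_smul, inv_mul_cancel₀ (lrCoeff_ne_zero hc (Nat.zero_le _)), one_smul]
    rw [h2, smul_smul] at h1
    rw [mul_comm]
    have hinj : Function.Injective (fun c : ℂ => c • (φ ⊗ₜ[ℂ] ψ : SS n h i j)) :=
      smul_left_injective (M := SS n h i j) ℂ (tmul_ne_zero hφ hψ)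
    exact hinj h1
  · rintro ⟨c, hc'⟩
    refine ⟨c • (φ ⊗ₜ ψ), fun p hp => ?_⟩
    rw [hc' (j + p) (Finset.mem_Icc.mpr (by omega)), mul_comm, mul_smul]

theorem exists_ne_zero_iff_LRCond (hh : h ≤ n)
    {φ : spaceS (BlockA n h) i} {ψ : spaceS (BlockB n h) j} (hφ : φ ≠ 0) (hψ : ψ ≠ 0) :
    (∃ α : ℕ → ℂ, (∃ l ∈ lRange n h k i j, α l ≠ 0) ∧
        radonD (Fin n) (∑ l ∈ lRange n h k i j, α l • box n h (radonR (BlockA n h) (k - l - i) φ)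
          (radonR (BlockB n h) (l - j) ψ)) = 0) ↔ LRCond n h k i j := by
  constructor
  · rintro ⟨α, ⟨l, hl, hαl⟩, hα⟩
    rw [lRange, Finset.mem_filter, Finset.mem_range] at hl
    by_contra hc
    have hij : i + j ≤ k := by omega
    rw [sum_lRange_eq_stringSum hh hij, radonD_stringSum_eq_zero_iff hh] at hα
    have h0 := eq_zero_of_recursion (T := SS n h i j) hij hc
      (fun p => α (j + p) • φ ⊗ₜ ψ) hα (l - j) (by omega) (by omega) (by omega)
    rw [show j + (l - j) = l by omega] at h0
    exact (smul_ne_zero hαl (tmul_ne_zero hφ hψ)) h0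
  · intro hc
    refine ⟨lrCoeff n h k i j, ⟨j, ?_, lrCoeff_ne_zero hc (p := 0) (Nat.zero_le _)⟩, ?_⟩
    · rw [lRange_eq_Icc hc, Finset.mem_Icc]
      have := hc.2.2
      omega
    · rw [radonD_sum_eq_zero_iff hh hc _ hφ hψ]
      exact ⟨1, fun l _ => (one_mul _).symm⟩

/-! ### Irreducibility -/

section Zonal

variable {X : Type} [Fintype X] [DecidableEq X]

/-- The zonal function at a `k`-set, as an element of `S^{t-k,k}`. -/
noncomputable def zonalS {k : ℕ} (hk : 2 * k ≤ Fintype.card X) (Y : Finset X) (hY : Y.card = k) :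
    spaceS X k :=
  ⟨zonal Y, by subst hY; exact zonal_mem_spaceS hk⟩

theorem coe_repS {k : ℕ} (g : Equiv.Perm X) (f : spaceS X k) :
    (repS X k g f : Finset X → ℂ) = permRep X g f := rfl

theorem repS_zonalS {k : ℕ} (hk : 2 * k ≤ Fintype.card X) (g : Equiv.Perm X) (Y : Finset X)
    (hY : Y.card = k) :
    repS X k g (zonalS hk Y hY) = zonalS hk (Y.map g.toEmbedding) (by rwa [Finset.card_map]) :=
  Subtype.ext (permRep_zonal g Y)

theorem sum_stab_repS {k : ℕ} (hk : 2 * k ≤ Fintype.card X) (Y : Finset X) (hY : Y.card = k)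
    (f : spaceS X k) :
    ∑ g ∈ stab Y, repS X k g f =
      (((stab Y).card : ℂ) * (f : Finset X → ℂ) Y) • zonalS hk Y hY := by
  subst hY
  refine Subtype.ext ?_
  rw [Submodule.coe_sum, Submodule.coe_smul]
  exact sum_stab_eq hk f.2

theorem eq_top_of_zonalS_mem {k : ℕ} (hk : 2 * k ≤ Fintype.card X)
    {N : Submodule ℂ (spaceS X k)} (hN : ∀ Y hY, zonalS hk Y hY ∈ N) : N = ⊤ := by
  rw [eq_top_iff]
  intro f _
  have hle : Submodule.span ℂ (zonal '' {Y : Finset X | Y.card = k}) ≤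
      N.map (spaceS X k).subtype := by
    rw [Submodule.span_le]
    rintro _ ⟨Y, hY, rfl⟩
    exact ⟨zonalS hk Y hY, hN Y hY, rfl⟩
  obtain ⟨g, hg, hgf⟩ := hle (mem_span_zonal hk f.2)
  rwa [← Subtype.ext hgf]

end Zonal

theorem repSS_tmul (g : Young n h) (φ : spaceS (BlockA n h) i) (ψ : spaceS (BlockB n h) j) :
    repSS n h i j g (φ ⊗ₜ ψ) = repS _ i g.1 φ ⊗ₜ repS _ j g.2 ψ := rfl

/-- A nonzero element of the tensor product has a nonzero value, at `Y ∪ Y'` say; averaging it over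
the stabilizers of `Y` and `Y'` leaves a nonzero multiple of the product of the zonal functions at
`Y` and `Y'`, whose translates span. -/
theorem isIrreducible_repSS (hh : h ≤ n) (hi : 2 * i ≤ h) (hj : 2 * j + h ≤ n) :
    Representation.IsIrreducible (k := ℂ) (G := Young n h) (V := SS n h i j)
      (repSS n h i j) := by
  have hA : 2 * i ≤ Fintype.card (BlockA n h) := by rw [card_blockA hh]; exact hi
  have hB : 2 * j ≤ Fintype.card (BlockB n h) := by rw [card_blockB hh]; omega
  have havg : ∀ (Z : Finset (Fin n)) (hY : (splitEquiv n h Z).1.card = i)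
      (hY' : (splitEquiv n h Z).2.card = j) (t : SS n h i j),
      ∑ g ∈ stab (splitEquiv n h Z).1, ∑ g' ∈ stab (splitEquiv n h Z).2, repSS n h i j (g, g') t =
        (((stab (splitEquiv n h Z).1).card : ℂ) * (stab (splitEquiv n h Z).2).card *
          boxR n h i j 0 0 t Z) • (zonalS hA _ hY ⊗ₜ zonalS hB _ hY') := by
    intro Z hY hY' t
    induction t using TensorProduct.induction_on with
    | zero => simp
    | add t t' ht ht' =>
      simp only [map_add, Finset.sum_add_distrib, ht, ht', Pi.add_apply, mul_add, add_smul]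
    | tmul φ ψ =>
      simp only [repSS_tmul, ← TensorProduct.tmul_sum, ← TensorProduct.sum_tmul]
      rw [sum_stab_repS hA _ hY, sum_stab_repS hB _ hY', TensorProduct.smul_tmul_smul, boxR_tmul,
        box_apply, radonR_zero, radonR_zero]
      congr 1
      simp only [LinearMap.id_apply]
      ring
  have hpt : ∀ t : SS n h i j, t ≠ 0 → ∃ Z, boxR n h i j 0 0 t Z ≠ 0 := by
    intro t ht
    by_contra! hc
    exact ht ((injective_iff_map_eq_zero _).mp (boxR_injective hh hi (by omega)) t (funext hc))
  have hnt : Nontrivial (Subrepresentation (repSS n h i j)) := by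
    obtain ⟨Y, -, hY⟩ : ∃ Y ⊆ (Finset.univ : Finset (BlockA n h)), Y.card = i :=
      Finset.exists_subset_card_eq (by rw [Finset.card_univ]; omega)
    obtain ⟨Y', -, hY'⟩ : ∃ Y' ⊆ (Finset.univ : Finset (BlockB n h)), Y'.card = j :=
      Finset.exists_subset_card_eq (by rw [Finset.card_univ]; omega)
    have h0 : (zonalS hA Y hY) ⊗ₜ[ℂ] (zonalS hB Y' hY') ≠ 0 := by
      refine tmul_ne_zero (fun h0 => ?_) (fun h0 => ?_)
      · have h1 := zonal_self Y
        rw [show zonal Y = 0 from congrArg Subtype.val h0] at h1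
        simp at h1
      · have h1 := zonal_self Y'
        rw [show zonal Y' = 0 from congrArg Subtype.val h0] at h1
        simp at h1
    refine ⟨⟨⊥, ⊤, fun hbt => h0 ?_⟩⟩
    have h2 := congrArg Subrepresentation.toSubmodule hbt
    have h3 : (zonalS hA Y hY) ⊗ₜ[ℂ] (zonalS hB Y' hY') ∈
        (⊥ : Subrepresentation (repSS n h i j)).toSubmodule := by
      rw [h2]
      exact Submodule.mem_top
    exact (Submodule.mem_bot ℂ).mp h3
  refine { hnt with eq_bot_or_eq_top := fun U => ?_ }
  by_cases hU : ∃ t ∈ U.toSubmodule, t ≠ 0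
  swap
  · left
    push Not at hU
    refine Subrepresentation.toSubmodule_injective ?_
    exact (Submodule.eq_bot_iff _).mpr hU
  right
  obtain ⟨t, htU, ht⟩ := hU
  obtain ⟨Z, hZ⟩ := hpt t ht
  have hY : (splitEquiv n h Z).1.card = i := by
    by_contra hc
    exact hZ (boxR_apply_eq_zero t (Or.inl hc))
  have hY' : (splitEquiv n h Z).2.card = j := by
    by_contra hc
    exact hZ (boxR_apply_eq_zero t (Or.inr hc))
  have h1 : zonalS hA _ hY ⊗ₜ zonalS hB _ hY' ∈ U.toSubmodule := by
    have h2 : ∑ g ∈ stab (splitEquiv n h Z).1, ∑ g' ∈ stab (splitEquiv n h Z).2,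
        repSS n h i j (g, g') t ∈ U.toSubmodule :=
      Submodule.sum_mem _ (fun g _ => Submodule.sum_mem _ (fun g' _ =>
        U.apply_mem_toSubmodule _ htU))
    rw [havg Z hY hY' t] at h2
    exact (Submodule.smul_mem_iff _ (mul_ne_zero (mul_ne_zero (card_stab_ne_zero _)
      (card_stab_ne_zero _)) hZ)).mp h2
  have h2 : ∀ V hV V' hV', zonalS hA V hV ⊗ₜ zonalS hB V' hV' ∈ U.toSubmodule := by
    intro V hV V' hV'
    obtain ⟨g, rfl⟩ := exists_perm_map_eq (hY.trans hV.symm)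
    obtain ⟨g', rfl⟩ := exists_perm_map_eq (hY'.trans hV'.symm)
    have h3 := U.apply_mem_toSubmodule (g, g') h1
    rwa [repSS_tmul, repS_zonalS, repS_zonalS] at h3
  have h3 : ∀ V hV (ψ : spaceS (BlockB n h) j), zonalS hA V hV ⊗ₜ ψ ∈ U.toSubmodule := by
    intro V hV ψ
    have := eq_top_of_zonalS_mem hB
      (N := U.toSubmodule.comap (TensorProduct.mk ℂ _ _ (zonalS hA V hV))) (h2 V hV)
    exact (this ▸ Submodule.mem_top : ψ ∈ U.toSubmodule.comap _)
  have h4 : ∀ (φ : spaceS (BlockA n h) i) (ψ : spaceS (BlockB n h) j),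
      φ ⊗ₜ ψ ∈ U.toSubmodule := by
    intro φ ψ
    have := eq_top_of_zonalS_mem hA
      (N := U.toSubmodule.comap ((TensorProduct.mk ℂ _ _).flip ψ)) (fun V hV => h3 V hV ψ)
    exact (this ▸ Submodule.mem_top : φ ∈ U.toSubmodule.comap _)
  refine Subrepresentation.toSubmodule_injective (eq_top_iff.mpr (fun t _ => ?_))
  induction t using TensorProduct.induction_on with
  | zero => exact Submodule.zero_mem _
  | add t t' ht ht' => exact Submodule.add_mem _ (ht trivial) (ht' trivial)
  | tmul φ ψ => exact h4 φ ψ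

/-! ### An operator that separates the summands -/

section SwapSum

variable {V W : Type} [AddCommMonoid V] [Module ℂ V] [AddCommMonoid W] [Module ℂ W]

/-- The sum of `swap x y` over all ordered pairs of points of `A` (equal points included), plus the
imaginary unit times the same sum for `B`, acting in a representation of `S_h × S_{n-h}`. The
imaginary unit makes the eigenvalue record both of the two sums, whose eigenvalues are real. -/
noncomputable def swapSum (ρ : Representation ℂ (Young n h) V) : V →ₗ[ℂ] V :=
  (∑ x, ∑ y, ρ (Equiv.swap x y, 1)) + Complex.I • ∑ x, ∑ y, ρ (1, Equiv.swap x y)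

theorem map_swapSum {ρ : Representation ℂ (Young n h) V} {σ : Representation ℂ (Young n h) W}
    (T : V →ₗ[ℂ] W) (hT : ∀ g v, T (ρ g v) = σ g (T v)) (v : V) :
    T (swapSum ρ v) = swapSum σ (T v) := by
  simp only [swapSum, LinearMap.add_apply, LinearMap.smul_apply, LinearMap.sum_apply, map_add,
    map_smul, map_sum, hT]

end SwapSum

/-- The eigenvalue of `swapSum` on `S^{h-i,i}(A) ⊗ S^{n-h-j,j}(B)`. -/
noncomputable def blockScalar (n h i j : ℕ) : ℂ :=
  swapScalar h i + Complex.I * swapScalar (n - h) j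

theorem swapScalar_im (t i : ℕ) : (swapScalar t i).im = 0 := by
  have : swapScalar t i = (((i : ℝ) ^ 2 + ((t : ℝ) - i) ^ 2 - 2 * i : ℝ) : ℂ) := by
    rw [swapScalar]
    push_cast
    ring
  rw [this, Complex.ofReal_im]

theorem blockScalar_inj {i' j' : ℕ} (hi : 2 * i ≤ h) (hj : 2 * j + h ≤ n)
    (hi' : 2 * i' ≤ h) (hj' : 2 * j' + h ≤ n)
    (he : blockScalar n h i j = blockScalar n h i' j') : i = i' ∧ j = j' := by
  have h1 := congrArg Complex.re he
  have h2 := congrArg Complex.im he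
  simp only [blockScalar, Complex.add_re, Complex.add_im, Complex.mul_re, Complex.mul_im,
    Complex.I_re, Complex.I_im, swapScalar_im, zero_mul, one_mul, sub_zero, add_zero,
    zero_add] at h1 h2
  exact ⟨swapScalar_injOn hi hi' (Complex.ext h1 (by rw [swapScalar_im, swapScalar_im])),
    swapScalar_injOn (by omega) (by omega)
      (Complex.ext h2 (by rw [swapScalar_im, swapScalar_im]))⟩

theorem sum_swap_repS {X : Type} [Fintype X] [DecidableEq X] (φ : spaceS X i) :
    ∑ x, ∑ y, repS X i (Equiv.swap x y) φ = swapScalar (Fintype.card X) i • φ := by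
  refine Subtype.ext ?_
  simp only [Submodule.coe_sum, Submodule.coe_smul, coe_repS]
  exact sum_swap_of_mem_spaceS φ.2

theorem swapSum_repSS (hh : h ≤ n) (t : SS n h i j) :
    swapSum (repSS n h i j) t = blockScalar n h i j • t := by
  induction t using TensorProduct.induction_on with
  | zero => simp
  | add t t' ht ht' => rw [map_add, ht, ht', smul_add]
  | tmul φ ψ =>
    simp only [swapSum, LinearMap.add_apply, LinearMap.smul_apply, LinearMap.sum_apply, repSS_tmul,
      map_one, Module.End.one_apply, ← TensorProduct.tmul_sum, ← TensorProduct.sum_tmul,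
      sum_swap_repS, card_blockA hh, card_blockB hh]
    rw [← TensorProduct.smul_tmul', TensorProduct.tmul_smul, smul_smul, ← add_smul, blockScalar]

theorem mem_eigenspace_of_intertwining (hh : h ≤ n) {W : Type} [AddCommGroup W] [Module ℂ W]
    {σ : Representation ℂ (Young n h) W} (T : SS n h i j →ₗ[ℂ] W)
    (hT : ∀ g t, T (repSS n h i j g t) = σ g (T t)) (t : SS n h i j) :
    T t ∈ Module.End.eigenspace (swapSum σ) (blockScalar n h i j) := by
  rw [Module.End.mem_eigenspace_iff, ← map_swapSum T hT, swapSum_repSS hh, map_smul]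

/-! ### The immersions -/

/-- `stringSum` as a linear map in the sequence `t`. -/
noncomputable def stringHom (n h i j m : ℕ) : (ℕ → SS n h i j) →ₗ[ℂ] (Finset (Fin n) → ℂ) :=
  ∑ p ∈ Finset.range (m + 1), boxR n h i j (m - p) p ∘ₗ LinearMap.proj p

theorem stringHom_apply (m : ℕ) (t : ℕ → SS n h i j) :
    stringHom n h i j m t = stringSum n h i j m t := by
  simp [stringHom, stringSum]

/-- The sequence of multiples of `s` by the Hahn coefficients. -/
noncomputable def hahnSeq (n h k i j : ℕ) : SS n h i j →ₗ[ℂ] (ℕ → SS n h i j) :=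
  LinearMap.pi (fun p => lrCoeff n h k i j (j + p) • LinearMap.id)

theorem hahnSeq_apply (s : SS n h i j) (p : ℕ) :
    hahnSeq n h k i j s p = lrCoeff n h k i j (j + p) • s := rfl

theorem stringHom_hahnSeq_mem (hh : h ≤ n) (hc : LRCond n h k i j) (s : SS n h i j) :
    (stringHom n h i j (k - i - j) ∘ₗ hahnSeq n h k i j) s ∈ spaceS (Fin n) k := by
  rw [LinearMap.comp_apply, stringHom_apply]
  refine ⟨?_, ?_⟩
  · have h1 := stringSum_mem_funM (m := k - i - j) (hahnSeq n h k i j s)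
    have h2 := hc.2.2
    rwa [show i + j + (k - i - j) = k by omega] at h1
  · rw [SetLike.mem_coe, LinearMap.mem_ker, radonD_stringSum_eq_zero_iff hh]
    exact (recursion_iff_of_LRCond (T := SS n h i j) hc _).mpr ⟨s, fun p _ => rfl⟩

/-- The immersion of `S^{h-i,i}(A) ⊗ S^{n-h-j,j}(B)` in the restriction of `S^{n-k,k}`. -/
noncomputable def lrMap (hh : h ≤ n) (hc : LRCond n h k i j) :
    Representation.IntertwiningMap (repSS n h i j) (resS n h k) where
  toLinearMap := LinearMap.codRestrict (spaceS (Fin n) k)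
    (stringHom n h i j (k - i - j) ∘ₗ hahnSeq n h k i j) (stringHom_hahnSeq_mem hh hc)
  isIntertwining' g := by
    refine LinearMap.ext (fun s => Subtype.ext ?_)
    have h1 := stringSum_repSS (k - i - j) g (hahnSeq n h k i j s)
    rw [← stringHom_apply, ← stringHom_apply] at h1
    have h2 : (fun p => repSS n h i j g (hahnSeq n h k i j s p)) =
        hahnSeq n h k i j (repSS n h i j g s) := by
      ext p
      rw [hahnSeq_apply, hahnSeq_apply, map_smul]
    rw [h2] at h1
    exact h1

theorem coe_lrMap (hh : h ≤ n) (hc : LRCond n h k i j) (s : SS n h i j) :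
    (lrMap hh hc s : Finset (Fin n) → ℂ) =
      stringSum n h i j (k - i - j) (hahnSeq n h k i j s) :=
  stringHom_apply _ _

theorem lrMap_tmul (hh : h ≤ n) (hc : LRCond n h k i j) (φ : spaceS (BlockA n h) i)
    (ψ : spaceS (BlockB n h) j) :
    (lrMap hh hc (φ ⊗ₜ[ℂ] ψ) : Finset (Fin n) → ℂ) =
      ∑ l ∈ Finset.Icc j (k - i), lrCoeff n h k i j l •
        box n h (radonR (BlockA n h) (k - l - i) φ) (radonR (BlockB n h) (l - j) ψ) := by
  rw [coe_lrMap, sum_Icc_eq_stringSum hc.2.2]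
  rfl

theorem lrMap_injective (hh : h ≤ n) (hc : LRCond n h k i j) (hj : 2 * j + h ≤ n) :
    Function.Injective (lrMap hh hc) := by
  rw [injective_iff_map_eq_zero]
  intro s hs
  have h1 := coe_lrMap hh hc s
  rw [hs] at h1
  have h2 := (stringSum_eq_zero_iff hh _).mp h1.symm 0 (Nat.zero_le _)
    (by obtain ⟨h1, h2, h3⟩ := hc; omega) (by omega)
  rw [hahnSeq_apply] at h2
  exact (smul_eq_zero.mp h2).resolve_left (lrCoeff_ne_zero hc (Nat.zero_le _))

/-! ### The decomposition -/

/-- Every function on `k`-subsets is a sum of string sums. -/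
theorem funM_le_iSup_stringHom (hh : h ≤ n) (k : ℕ) :
    funM (Fin n) k ≤ ⨆ p : {p : ℕ × ℕ // 2 * p.1 ≤ h ∧ 2 * p.2 + h ≤ n ∧ p.1 + p.2 ≤ k},
      LinearMap.range (stringHom n h p.1.1 p.1.2 (k - p.1.1 - p.1.2)) := by
  intro f hf
  have hsum : f = ∑ Z, f Z • dirac Z := by
    ext W
    simp [dirac, Pi.single_apply]
  rw [hsum]
  refine Submodule.sum_mem _ (fun Z _ => ?_)
  by_cases hZ : Z.card = k
  swap
  · rw [hf Z hZ, zero_smul]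
    exact Submodule.zero_mem _
  refine Submodule.smul_mem _ _ ?_
  have hcard := card_split (h := h) Z
  have hdirac : ∀ {X : Type} [Fintype X] [DecidableEq X] (Y : Finset X),
      dirac Y ∈ funM X Y.card := by
    intro X _ _ Y W hW
    rw [dirac, Pi.single_apply, if_neg (fun e => hW (by rw [e]))]
  obtain ⟨φ, hφ⟩ := exists_eq_sum_radonR (hdirac (splitEquiv n h Z).1)
  obtain ⟨ψ, hψ⟩ := exists_eq_sum_radonR (hdirac (splitEquiv n h Z).2)
  rw [dirac_eq_box (h := h), hφ, hψ, ← boxHom_apply, LinearMap.map_sum₂]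
  refine Submodule.sum_mem _ (fun i hi => ?_)
  rw [map_sum]
  refine Submodule.sum_mem _ (fun j hj => ?_)
  rw [Finset.mem_range, splitEquiv_apply] at hi hj
  rw [boxHom_apply, ← boxR_tmul, splitEquiv_apply]
  by_cases hij : 2 * i ≤ h ∧ 2 * j + h ≤ n
  swap
  · rw [boxR_eq_zero hh (by omega)]
    exact Submodule.zero_mem _
  refine Submodule.mem_iSup_of_mem ⟨(i, j), hij.1, hij.2, by
    change i + j ≤ k
    dsimp only at hi hj
    omega⟩ ?_
  refine ⟨Pi.single ((Z.subtype (fun x => ¬ inA n h x)).card - j) (φ i ⊗ₜ ψ j), ?_⟩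
  dsimp only at hi hj ⊢
  rw [stringHom_apply, stringSum, Finset.sum_eq_single
    ((Z.subtype (fun x => ¬ inA n h x)).card - j)]
  · rw [Pi.single_eq_same, show k - i - j - ((Z.subtype (fun x => ¬ inA n h x)).card - j) =
      (Z.subtype (inA n h)).card - i by omega]
  · intro p _ hp
    rw [Pi.single_eq_of_ne hp, map_zero]
  · intro hp
    rw [Finset.mem_range] at hp
    omega

theorem stringSum_mem_eigenspace (hh : h ≤ n) (m : ℕ) (t : ℕ → SS n h i j) :
    stringSum n h i j m t ∈
      Module.End.eigenspace (swapSum (youngRep n h)) (blockScalar n h i j) :=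
  Submodule.sum_mem _ (fun p _ =>
    mem_eigenspace_of_intertwining hh (boxR n h i j (m - p) p) (boxR_repSS _ _) (t p))

theorem radonD_mem_eigenspace {f : Finset (Fin n) → ℂ} {μ : ℂ}
    (hf : f ∈ Module.End.eigenspace (swapSum (youngRep n h)) μ) :
    radonD (Fin n) f ∈ Module.End.eigenspace (swapSum (youngRep n h)) μ := by
  rw [Module.End.mem_eigenspace_iff] at hf ⊢
  rw [← map_swapSum (ρ := youngRep n h) (σ := youngRep n h) (radonD (Fin n))
    (fun g v => radonD_permRep (youngHom n h g) v), hf, map_smul]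

theorem eq_zero_of_sum_eq_zero {ι M : Type} [AddCommGroup M] [Module ℂ M]
    {E : ι → Submodule ℂ M} (hE : iSupIndep E) {s : Finset ι} {y : ι → M} (hy : ∀ p, y p ∈ E p)
    (hsum : ∑ p ∈ s, y p = 0) {p : ι} (hp : p ∈ s) : y p = 0 := by
  classical
  refine Submodule.disjoint_def.mp (hE p) _ (hy p) ?_
  rw [← Finset.add_sum_erase s y hp] at hsum
  rw [eq_neg_of_add_eq_zero_left hsum]
  refine Submodule.neg_mem _ (Submodule.sum_mem _ (fun q hq => ?_))
  exact Submodule.mem_iSup_of_mem q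
    (Submodule.mem_iSup_of_mem (Finset.ne_of_mem_erase hq) (hy q))

/-- If `d` kills a sum of string sums that belong to different pairs `(i, j)`, it kills each of
them, because `d` preserves the eigenspaces of `swapSum`; and the string sums killed by `d` are in
the images of the immersions. -/
theorem iSup_range_lrMap (hh : h ≤ n) (k : ℕ) :
    ⨆ p : LRPair n h k, (lrMap hh p.2.2.2).range.toSubmodule = ⊤ := by
  rw [eq_top_iff]
  intro f _
  obtain ⟨x, hx, hxf⟩ := (Submodule.mem_iSup_iff_exists_finsupp _ _).mp
    (funM_le_iSup_stringHom hh k f.2.1)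
  choose t ht using hx
  have hinj : Function.Injective
      (fun p : {p : ℕ × ℕ // 2 * p.1 ≤ h ∧ 2 * p.2 + h ≤ n ∧ p.1 + p.2 ≤ k} =>
        blockScalar n h p.1.1 p.1.2) := by
    intro p q hpq
    obtain ⟨h1, h2⟩ := blockScalar_inj p.2.1 p.2.2.1 q.2.1 q.2.2.1 hpq
    exact Subtype.ext (Prod.ext h1 h2)
  have hd : ∀ p, radonD (Fin n) (x p) = 0 := by
    intro p
    by_cases hp : p ∈ x.support
    · refine eq_zero_of_sum_eq_zero (y := fun p => radonD (Fin n) (x p))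
        ((Module.End.eigenspaces_iSupIndep (swapSum (youngRep n h))).comp hinj) ?_ ?_ hp
      · intro q
        refine radonD_mem_eigenspace ?_
        rw [← ht, stringHom_apply]
        exact stringSum_mem_eigenspace hh _ _
      · rw [← map_sum]
        exact (congrArg (radonD (Fin n)) hxf).trans (LinearMap.mem_ker.mp f.2.2)
    · rw [Finsupp.notMem_support_iff.mp hp, map_zero]
  have hmem : (f : Finset (Fin n) → ℂ) ∈
      (⨆ p : LRPair n h k, (lrMap hh p.2.2.2).range.toSubmodule).map
        (spaceS (Fin n) k).subtype := by
    rw [← hxf]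
    refine Submodule.sum_mem _ (fun p _ => ?_)
    have hdp := hd p
    rw [← ht p, stringHom_apply, radonD_stringSum_eq_zero_iff hh] at hdp
    change x p ∈ _
    rw [← ht p, stringHom_apply]
    by_cases hc : LRCond n h k p.1.1 p.1.2
    · obtain ⟨s, hs⟩ := (recursion_iff_of_LRCond (T := SS n h p.1.1 p.1.2) hc (t p)).mp hdp
      refine ⟨lrMap hh hc s, Submodule.mem_iSup_of_mem
        (⟨p.1, p.2.1, p.2.2.1, hc⟩ : LRPair n h k) ⟨s, rfl⟩, ?_⟩
      rw [Submodule.subtype_apply, coe_lrMap]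
      refine Finset.sum_congr rfl (fun r hr => ?_)
      rw [Finset.mem_range] at hr
      rw [hs r (by omega), hahnSeq_apply]
    · have h0 := eq_zero_of_recursion (T := SS n h p.1.1 p.1.2) p.2.2.2 hc (t p) hdp
      rw [(stringSum_eq_zero_iff hh (t p)).mpr h0]
      exact Submodule.zero_mem _
  obtain ⟨g, hg, hgf⟩ := hmem
  rwa [← Subtype.ext hgf]

theorem range_le_eigenspace (hh : h ≤ n)
    (S : Representation.IntertwiningMap (repSS n h i j) (resS n h k)) :
    S.range.toSubmodule ≤
      Module.End.eigenspace (swapSum (resS n h k)) (blockScalar n h i j) := by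
  rintro _ ⟨t, rfl⟩
  exact mem_eigenspace_of_intertwining hh S.toLinearMap (S.isIntertwining _ _) t

theorem blockScalar_injective_LRPair (n h k : ℕ) :
    Function.Injective (fun p : LRPair n h k => blockScalar n h p.1.1 p.1.2) := by
  intro p q hpq
  obtain ⟨h1, h2⟩ := blockScalar_inj p.2.1 p.2.2.1 q.2.1 q.2.2.1 hpq
  exact Subtype.ext (Prod.ext h1 h2)

theorem isInternal_range_lrMap (hh : h ≤ n) (k : ℕ) :
    DirectSum.IsInternal (fun p : LRPair n h k => (lrMap hh p.2.2.2).range.toSubmodule) := by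
  refine DirectSum.isInternal_submodule_of_iSupIndep_of_iSup_eq_top ?_ (iSup_range_lrMap hh k)
  exact ((Module.End.eigenspaces_iSupIndep (swapSum (resS n h k))).comp
    (blockScalar_injective_LRPair n h k)).mono (fun p => range_le_eigenspace hh (lrMap hh p.2.2.2))

/-- An equivalence would identify the eigenvalues of `swapSum`. -/
theorem isEmpty_equiv (hh : h ≤ n) {p q : LRPair n h k} (hpq : p ≠ q) :
    IsEmpty ((repSS n h p.1.1 p.1.2).Equiv (repSS n h q.1.1 q.1.2)) := by
  refine ⟨fun e => hpq (blockScalar_injective_LRPair n h k ?_)⟩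
  have hirr := isIrreducible_repSS hh p.2.1 p.2.2.1
  obtain ⟨t, ht⟩ : ∃ t : SS n h p.1.1 p.1.2, t ≠ 0 := by
    by_contra! h0
    obtain ⟨U, U', hU⟩ := hirr.exists_pair_ne
    refine hU (Subrepresentation.toSubmodule_injective (Submodule.ext (fun t => ?_)))
    rw [h0 t]
    exact iff_of_true (Submodule.zero_mem _) (Submodule.zero_mem _)
  have h1 := map_swapSum e.toIntertwiningMap.toLinearMap
    (e.toIntertwiningMap.isIntertwining _ _) t
  rw [swapSum_repSS hh, swapSum_repSS hh, map_smul] at h1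
  have h2 : e.toIntertwiningMap.toLinearMap t ≠ 0 :=
    fun h0 => ht (e.toLinearEquiv.map_eq_zero_iff.mp h0)
  exact smul_left_injective (M := SS n h q.1.1 q.1.2) ℂ h2 h1

/-! ### Multiplicities -/

/-- The eigenvalue of the pair `(i, j)` does not occur on the summands of the other pairs. -/
theorem eigenspace_disjoint (hh : h ≤ n) (hi : 2 * i ≤ h) (hj : 2 * j + h ≤ n) :
    Disjoint (Module.End.eigenspace (swapSum (resS n h k)) (blockScalar n h i j))
      (⨆ p : LRPair n h k, ⨆ _ : p.1 ≠ (i, j), (lrMap hh p.2.2.2).range.toSubmodule) := by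
  refine (Module.End.eigenspaces_iSupIndep (swapSum (resS n h k)) (blockScalar n h i j)).mono_right
    (iSup₂_le (fun p hp => ?_))
  refine (range_le_eigenspace hh (lrMap hh p.2.2.2)).trans
    (le_iSup₂_of_le (blockScalar n h p.1.1 p.1.2) (fun he => hp ?_) le_rfl)
  obtain ⟨h1, h2⟩ := blockScalar_inj p.2.1 p.2.2.1 hi hj he
  exact Prod.ext h1 h2

theorem multiplicity_eq_zero (hh : h ≤ n) (hi : 2 * i ≤ h) (hj : 2 * j + h ≤ n)
    (hc : ¬ LRCond n h k i j) : multiplicity (repSS n h i j) (resS n h k) = 0 := by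
  have h0 : ∀ S : Representation.IntertwiningMap (repSS n h i j) (resS n h k), S = 0 := by
    intro S
    refine Representation.IntertwiningMap.ext (LinearMap.ext (fun t => ?_))
    refine Submodule.disjoint_def.mp (eigenspace_disjoint hh hi hj) _
      (range_le_eigenspace hh S ⟨t, rfl⟩) ?_
    have htop : S.toLinearMap t ∈ (⊤ : Submodule ℂ (spaceS (Fin n) k)) := Submodule.mem_top
    rw [← iSup_range_lrMap hh k] at htop
    have hle : (⨆ p : LRPair n h k, (lrMap hh p.2.2.2).range.toSubmodule) ≤
        ⨆ p : LRPair n h k, ⨆ _ : p.1 ≠ (i, j), (lrMap hh p.2.2.2).range.toSubmodule := by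
      refine iSup_mono (fun p => le_iSup_of_le (fun he => hc ?_) le_rfl)
      have hp := p.2.2.2
      rwa [he] at hp
    exact hle htop
  have : Subsingleton (Representation.IntertwiningMap (repSS n h i j) (resS n h k)) :=
    ⟨fun S S' => (h0 S).trans (h0 S').symm⟩
  exact Module.finrank_zero_of_subsingleton

theorem eigenspace_le_range_lrMap (hh : h ≤ n) (hi : 2 * i ≤ h) (hj : 2 * j + h ≤ n)
    (hc : LRCond n h k i j) :
    Module.End.eigenspace (swapSum (resS n h k)) (blockScalar n h i j) ≤
      (lrMap hh hc).range.toSubmodule := by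
  intro x hx
  -- split `x` into its component in the image and a sum of components of other pairs
  have htop : x ∈ (⊤ : Submodule ℂ (spaceS (Fin n) k)) := Submodule.mem_top
  have hle : (⊤ : Submodule ℂ (spaceS (Fin n) k)) ≤ (lrMap hh hc).range.toSubmodule ⊔
      ⨆ p : LRPair n h k, ⨆ _ : p.1 ≠ (i, j), (lrMap hh p.2.2.2).range.toSubmodule := by
    rw [← iSup_range_lrMap hh k]
    refine iSup_le (fun p => ?_)
    by_cases hp : p.1 = (i, j)
    · obtain rfl : p = ⟨(i, j), hi, hj, hc⟩ := Subtype.ext hp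
      exact le_sup_left
    · exact le_sup_of_le_right (le_iSup₂_of_le p hp le_rfl)
  obtain ⟨y, hy, z, hz, rfl⟩ := Submodule.mem_sup.mp (hle htop)
  have hz0 : z = 0 := by
    refine Submodule.disjoint_def.mp (eigenspace_disjoint hh hi hj) _ ?_ hz
    simpa using Submodule.sub_mem _ hx (range_le_eigenspace hh (lrMap hh hc) hy)
  rwa [hz0, add_zero]

/-- Every intertwining map has its image in that of the immersion, hence factors through it, and
Schur's lemma applies. -/
theorem multiplicity_eq_one (hh : h ≤ n) (hi : 2 * i ≤ h) (hj : 2 * j + h ≤ n)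
    (hc : LRCond n h k i j) : multiplicity (repSS n h i j) (resS n h k) = 1 := by
  have hirr := isIrreducible_repSS hh hi hj
  have hTinj := lrMap_injective hh hc hj
  have hbij : Function.Bijective (Representation.IntertwiningMap.llcomp (repSS n h i j)
      (repSS n h i j) (resS n h k) (lrMap hh hc)) := by
    refine ⟨fun S S' hSS => ?_, fun S => ?_⟩
    · refine Representation.IntertwiningMap.ext (LinearMap.ext (fun t => hTinj ?_))
      exact congrArg
        (fun R : Representation.IntertwiningMap (repSS n h i j) (resS n h k) => R t) hSS
    · have hker : LinearMap.ker (lrMap hh hc).toLinearMap = ⊥ :=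
        LinearMap.ker_eq_bot'.mpr (fun t ht => hTinj (ht.trans (map_zero (lrMap hh hc)).symm))
      -- a linear left inverse `g` of the immersion gives the factor `g ∘ S` of `S` through it
      obtain ⟨g, hg⟩ := LinearMap.exists_leftInverse_of_injective (V := SS n h i j) _ hker
      have hfac : ∀ t, lrMap hh hc (g (S t)) = S t := by
        intro t
        obtain ⟨s, hs⟩ := eigenspace_le_range_lrMap hh hi hj hc
          (range_le_eigenspace hh S ⟨t, rfl⟩)
        have hs' : lrMap hh hc s = S t := hs
        have h1 : g (lrMap hh hc s) = s := LinearMap.congr_fun hg s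
        rw [← hs', h1]
      refine ⟨⟨g ∘ₗ S.toLinearMap, fun x => LinearMap.ext (fun t => hTinj ?_)⟩, ?_⟩
      · change lrMap hh hc (g (S (repSS n h i j x t))) =
          lrMap hh hc (repSS n h i j x (g (S t)))
        rw [hfac, (lrMap hh hc).isIntertwining, hfac, S.isIntertwining]
      · exact Representation.IntertwiningMap.ext (LinearMap.ext hfac)
  rw [multiplicity, ← (LinearEquiv.ofBijective _ hbij).finrank_eq]
  exact Representation.IsIrreducible.finrank_intertwiningMap_self (k := ℂ) (G := Young n h)
    (V := SS n h i j) (repSS n h i j)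

end TwoRow

theorem mainTheorem1 (n h : ℕ) (hh : h ≤ n) :
    -- solving `d ∑ α_l (R_{k-l-i} φ) ⊗ (R_{l-j} ψ) = 0` for the coefficients `α_l`
    (∀ k i j : ℕ, 2 * i ≤ h → 2 * j + h ≤ n →
      ∀ φ ∈ TwoRow.spaceS (TwoRow.BlockA n h) i, φ ≠ 0 →
      ∀ ψ ∈ TwoRow.spaceS (TwoRow.BlockB n h) j, ψ ≠ 0 →
        ((∃ α : ℕ → ℂ, (∃ l ∈ TwoRow.lRange n h k i j, α l ≠ 0) ∧
            TwoRow.radonD (Fin n) (∑ l ∈ TwoRow.lRange n h k i j,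
              α l • TwoRow.box n h (TwoRow.radonR (TwoRow.BlockA n h) (k - l - i) φ)
                (TwoRow.radonR (TwoRow.BlockB n h) (l - j) ψ)) = 0) ↔
          TwoRow.LRCond n h k i j) ∧
        (TwoRow.LRCond n h k i j →
          TwoRow.lRange n h k i j = Finset.Icc j (k - i) ∧
          ∀ α : ℕ → ℂ,
            (TwoRow.radonD (Fin n) (∑ l ∈ TwoRow.lRange n h k i j,
              α l • TwoRow.box n h (TwoRow.radonR (TwoRow.BlockA n h) (k - l - i) φ)
                (TwoRow.radonR (TwoRow.BlockB n h) (l - j) ψ)) = 0 ↔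
              ∃ c : ℂ, ∀ l ∈ Finset.Icc j (k - i), α l = c * TwoRow.lrCoeff n h k i j l))) ∧
    -- the Littlewood-Richardson rule
    (∀ k : ℕ, 2 * k ≤ n →
      -- multiplicities
      (∀ i j : ℕ, 2 * i ≤ h → 2 * j + h ≤ n →
        Representation.IsIrreducible (k := ℂ) (G := TwoRow.Young n h) (V := TwoRow.SS n h i j)
          (TwoRow.repSS n h i j) ∧
        (TwoRow.LRCond n h k i j →
          TwoRow.multiplicity (TwoRow.repSS n h i j) (TwoRow.resS n h k) = 1) ∧
        (¬ TwoRow.LRCond n h k i j →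
          TwoRow.multiplicity (TwoRow.repSS n h i j) (TwoRow.resS n h k) = 0)) ∧
      -- the summands are pairwise inequivalent
      (∀ p q : TwoRow.LRPair n h k, p ≠ q →
        IsEmpty ((TwoRow.repSS n h p.1.1 p.1.2).Equiv (TwoRow.repSS n h q.1.1 q.1.2))) ∧
      -- explicit immersions, whose images decompose the restriction
      ∃ T : ∀ p : TwoRow.LRPair n h k,
          Representation.IntertwiningMap (TwoRow.repSS n h p.1.1 p.1.2) (TwoRow.resS n h k),
        (∀ p : TwoRow.LRPair n h k, Function.Injective (T p) ∧
          ∀ (φ : TwoRow.spaceS (TwoRow.BlockA n h) p.1.1)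
            (ψ : TwoRow.spaceS (TwoRow.BlockB n h) p.1.2),
            ((T p (φ ⊗ₜ[ℂ] ψ) : TwoRow.spaceS (Fin n) k) : Finset (Fin n) → ℂ) =
              ∑ l ∈ Finset.Icc p.1.2 (k - p.1.1),
                TwoRow.lrCoeff n h k p.1.1 p.1.2 l •
                  TwoRow.box n h (TwoRow.radonR (TwoRow.BlockA n h) (k - l - p.1.1) φ)
                    (TwoRow.radonR (TwoRow.BlockB n h) (l - p.1.2) ψ)) ∧
        DirectSum.IsInternal (fun p : TwoRow.LRPair n h k => (T p).range.toSubmodule)) := by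
  refine ⟨fun k i j _ _ φ hφ hφ0 ψ hψ hψ0 => ?_, fun k _ => ⟨fun i j hi hj => ?_, ?_, ?_⟩⟩
  · have hφ' : (⟨φ, hφ⟩ : TwoRow.spaceS (TwoRow.BlockA n h) i) ≠ 0 :=
      fun h0 => hφ0 (congrArg Subtype.val h0)
    have hψ' : (⟨ψ, hψ⟩ : TwoRow.spaceS (TwoRow.BlockB n h) j) ≠ 0 :=
      fun h0 => hψ0 (congrArg Subtype.val h0)
    have h1 := TwoRow.exists_ne_zero_iff_LRCond (k := k) hh hφ' hψ'
    refine ⟨h1, fun hc => ⟨TwoRow.lRange_eq_Icc hc, fun α => ?_⟩⟩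
    have h2 := TwoRow.radonD_sum_eq_zero_iff hh hc α hφ' hψ'
    exact h2
  · exact ⟨TwoRow.isIrreducible_repSS hh hi hj, TwoRow.multiplicity_eq_one hh hi hj,
      TwoRow.multiplicity_eq_zero hh hi hj⟩
  · exact fun p q hpq => TwoRow.isEmpty_equiv hh hpq
  · exact ⟨fun p => TwoRow.lrMap hh p.2.2.2, fun p =>
      ⟨TwoRow.lrMap_injective hh p.2.2.2 p.2.2.1, TwoRow.lrMap_tmul hh p.2.2.2⟩,
      TwoRow.isInternal_range_lrMap hh k⟩
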